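/- Let $\Delta>0$, $c_1>0$, $c_2\ge 0$ satisfy $\frac{c_2}{c_1}\Delta^2\le \frac53$, and let $\nu$ be the measure on $[-\Delta,\Delta]$ given by $d\nu(\alpha)=c_1\boldsymbol\delta(\alpha)+c_2|\alpha|\,d\alpha$, with $\boldsymbol\delta$ the Dirac measure at $0$. Put $\widehat\nu(x)=\int e^{-2\pi i x\alpha}\,d\nu(\alpha)$, and let $\mathcal H_\nu$ be the set of entire functions $f$ of exponential type at most $\pi\Delta$ with $\|f\|_\nu^2:=\int_{\mathbb R}|f(x)|^2\,\widehat\nu(x)\,dx<\infty$. Then $\mathcal H_\nu$, with the inner product $\langle f,g\rangle=\int_{\mathbb R} f(x)\overline{g(x)}\,\widehat\nu(x)\,dx$, is a reproducing kernel Hilbert space. Write $K_\nu$ for its reproducing kernel: $K_\nu(w,\cdot)\in\mathcal H_\nu$ and $f(w)=\langle f,K_\nu(w,\cdot)\rangle$ for all $f\in\mathcal H_\nu$, $w\in\mathbb C$. Let $\theta=\sqrt{\frac{c_2}{2c_1}}\,\Delta$ and \begin{align*} a(w)&=\frac{-2c_2\left(\cos(\pi\Delta w)+\pi\Delta w\sin(\pi\Delta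 w)\right)}{c_1(2c_1\pi^2w^2-c_2)\left(2\cos\theta+\sqrt{\frac{2c_2}{c_1}}\,\Delta\sin\theta\right)},\\ b(w)&=\sqrt{\frac{2c_2}{c_1}}\cdot\frac{i\pi w\cos(\pi\Delta w)}{(2c_1\pi^2w^2-c_2)\cos\theta},\qquad c(w)=\frac{2\pi^2w^2}{2c_1\pi^2w^2-c_2},\\ q(z)&=\frac{\sqrt{2c_1c_2}}{c_2-2c_1\pi^2z^2}\sin\theta\,\cos(\pi\Delta z)-\frac{2\pi c_1z}{c_2-2c_1\pi^2z^2}\cos\theta\,\sin(\pi\Delta z),\\ r(z)&=-i\,\frac{\sqrt{2c_1c_2}}{c_2-2c_1\pi^2z^2}\cos\theta\,\sin(\pi\Delta z)+i\,\frac{2\pi c_1z}{c_2-2c_1\pi^2z^2}\sin\theta\,\cos(\pi\Delta z). \end{align*} Then for all $w,z\in\mathbb C$, $$K_\nu(w,z)=a(\bar w)\,q(z)+b(\bar w)\,r(z)+c(\bar w)\,\frac{\sin\pi\Delta(z-\bar w)}{\pi(z-\bar w)},$$ where the last quotient has the value $\Delta$ at $z=\bar w$, and where, if $z$ or $w$ is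 one of the exceptional points $\pm\frac1\pi\sqrt{\frac{c_2}{2c_1}}$, the right-hand side is understood as its limit as $(w',z')\to(w,z)$ through pairs in which neither $w'$ nor $z'$ is exceptional. -/

import Mathlib

open MeasureTheory Filter Topology ComplexConjugate

noncomputable section

namespace PairCorrelation

/-- The Fourier transform `∫ e^{-2πixα} dν(α)` of a (finite) measure `ν` on the real line. -/
def nuHat (ν : Measure ℝ) (x : ℝ) : ℂ :=
  ∫ α : ℝ, Complex.exp (-2 * Real.pi * Complex.I * x * α) ∂ν

/-- `f` is of exponential type at most `τ`. -/
def ExpTypeLE (τ : ℝ) (f : ℂ → ℂ) : Prop :=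
  ∀ ε : ℝ, 0 < ε → ∃ C : ℝ, ∀ z : ℂ, ‖f z‖ ≤ C * Real.exp ((τ + ε) * ‖z‖)

/-- The set `𝓗_ν` of entire functions `f` of exponential type at most `πΔ` such that
`∫_ℝ |f(x)|² ν̂(x) dx` is finite. -/
def weightedPW (Δ : ℝ) (ν : Measure ℝ) : Set (ℂ → ℂ) :=
  {f | Differentiable ℂ f ∧ ExpTypeLE (Real.pi * Δ) f ∧
    Integrable (fun x : ℝ => ((‖f x‖ ^ 2 : ℝ) : ℂ) * nuHat ν x)}

/-- The reproducing kernel Hilbert space `H` of functions `ℂ → ℂ` is `𝓗_ν`: its elements are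
exactly the functions in `𝓗_ν`, and its inner product is the one of the norm
`‖f‖_ν² = ∫_ℝ |f(x)|² ν̂(x) dx`.  (The inner product is conjugate-linear in the first argument.) -/
def IsWeightedPW (Δ : ℝ) (ν : Measure ℝ) (H : Type*) [NormedAddCommGroup H]
    [InnerProductSpace ℂ H] [RKHS ℂ H ℂ ℂ] : Prop :=
  Set.range (fun (f : H) (z : ℂ) => f z) = weightedPW Δ ν ∧
    ∀ f g : H, inner ℂ f g = ∫ x : ℝ, conj (f x) * g x * nuHat ν x

/-- The reproducing kernel `K(w, z)` of `H` as a scalar function: `K(w, ·)` is the element of `H`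
with `f(w) = ⟨f, K(w, ·)⟩`, where `⟨·, ·⟩` is linear in the first argument. -/
def repKernel (H : Type*) [NormedAddCommGroup H] [InnerProductSpace ℂ H] [CompleteSpace H]
    [RKHS ℂ H ℂ ℂ] (w z : ℂ) : ℂ :=
  RKHS.kerFun H w (1 : ℂ) z

/-- Sanity check: `repKernel` has the reproducing property. -/
theorem inner_repKernel (H : Type*) [NormedAddCommGroup H] [InnerProductSpace ℂ H]
    [CompleteSpace H] [RKHS ℂ H ℂ ℂ] (w : ℂ) :
    ∃ k : H, (∀ z, k z = repKernel H w z) ∧ ∀ f : H, inner ℂ k f = f w :=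
  ⟨RKHS.kerFun H w (1 : ℂ), fun _ => rfl, fun f => by simp⟩

/-- The measure `c₁ δ + c₂ |α| dα` on `[-Δ, Δ]`. -/
def nuMeasure (Δ c₁ c₂ : ℝ) : Measure ℝ :=
  ENNReal.ofReal c₁ • Measure.dirac 0 +
    (volume.restrict (Set.Icc (-Δ) Δ)).withDensity (fun α => ENNReal.ofReal (c₂ * |α|))

/-- The number `θ = √(c₂ / (2 c₁)) Δ`. -/
def theta (Δ c₁ c₂ : ℝ) : ℝ := √(c₂ / (2 * c₁)) * Δ

def coefA (Δ c₁ c₂ : ℝ) (w : ℂ) : ℂ :=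
  -2 * c₂ * (Complex.cos (Real.pi * Δ * w) + Real.pi * Δ * w * Complex.sin (Real.pi * Δ * w)) /
    (c₁ * (2 * c₁ * Real.pi ^ 2 * w ^ 2 - c₂) *
      ((2 * Real.cos (theta Δ c₁ c₂) +
        √(2 * c₂ / c₁) * Δ * Real.sin (theta Δ c₁ c₂) : ℝ) : ℂ))

def coefB (Δ c₁ c₂ : ℝ) (w : ℂ) : ℂ :=
  (√(2 * c₂ / c₁) : ℝ) *
    (Complex.I * Real.pi * w * Complex.cos (Real.pi * Δ * w) /
      ((2 * c₁ * Real.pi ^ 2 * w ^ 2 - c₂) * (Real.cos (theta Δ c₁ c₂) : ℝ)))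

def coefC (c₁ c₂ : ℝ) (w : ℂ) : ℂ :=
  2 * Real.pi ^ 2 * w ^ 2 / (2 * c₁ * Real.pi ^ 2 * w ^ 2 - c₂)

def funQ (Δ c₁ c₂ : ℝ) (z : ℂ) : ℂ :=
  (√(2 * c₁ * c₂) : ℝ) / (c₂ - 2 * c₁ * Real.pi ^ 2 * z ^ 2) *
      (Real.sin (theta Δ c₁ c₂) : ℝ) * Complex.cos (Real.pi * Δ * z) -
    2 * Real.pi * c₁ * z / (c₂ - 2 * c₁ * Real.pi ^ 2 * z ^ 2) *
      (Real.cos (theta Δ c₁ c₂) : ℝ) * Complex.sin (Real.pi * Δ * z)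

def funR (Δ c₁ c₂ : ℝ) (z : ℂ) : ℂ :=
  -Complex.I * ((√(2 * c₁ * c₂) : ℝ) / (c₂ - 2 * c₁ * Real.pi ^ 2 * z ^ 2)) *
      (Real.cos (theta Δ c₁ c₂) : ℝ) * Complex.sin (Real.pi * Δ * z) +
    Complex.I * (2 * Real.pi * c₁ * z / (c₂ - 2 * c₁ * Real.pi ^ 2 * z ^ 2)) *
      (Real.sin (theta Δ c₁ c₂) : ℝ) * Complex.cos (Real.pi * Δ * z)

/-- The entire function `sin(πΔu) / (πu)`, with its value `Δ` at `u = 0`. -/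
def sincKernel (Δ : ℝ) (u : ℂ) : ℂ :=
  if u = 0 then (Δ : ℂ) else Complex.sin (Real.pi * Δ * u) / (Real.pi * u)

/-- The right-hand side of the kernel formula, as a function of `(w, z)`. -/
def kernelFormula (Δ c₁ c₂ : ℝ) (w z : ℂ) : ℂ :=
  coefA Δ c₁ c₂ (conj w) * funQ Δ c₁ c₂ z + coefB Δ c₁ c₂ (conj w) * funR Δ c₁ c₂ z +
    coefC c₁ c₂ (conj w) * sincKernel Δ (z - conj w)

/-- The exceptional points `±(1/π) √(c₂ / (2 c₁))`. -/
def exceptionalPoints (c₁ c₂ : ℝ) : Set ℂ :=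
  {((1 / Real.pi * √(c₂ / (2 * c₁)) : ℝ) : ℂ), -((1 / Real.pi * √(c₂ / (2 * c₁)) : ℝ) : ℂ)}

end PairCorrelation

end

open scoped FourierTransform

noncomputable section

namespace PairCorrelation

/-! ### The Fourier transform of functions in `L¹ ∩ L²` -/

/-! The bound on `c₂Δ²/c₁` keeps `ν̂` between two positive constants (`exists_le_weight`,
`exists_weight_le`). Hence `𝓗_ν` is the Paley–Wiener space of type `πΔ` with an equivalent norm, and
its elements are the transforms `∫ φ(t) e^{-2πitz} dt` with `φ` in `L²[-Δ/2, Δ/2]`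
(`mem_weightedPW_iff`).

On the Fourier side, multiplication by `ν̂` becomes `φ ↦ c₁φ + c₂ (|·| 1_{[-Δ,Δ]}) * φ`. By
Plancherel, the transform of `φ` represents evaluation at `w` exactly when `c₁φ(t) + c₂ ∫ |t - s|
φ(s) ds = e^{2πi w̄ t}` on `[-Δ/2, Δ/2]`. Two derivatives turn this into `c₁φ'' + 2c₂φ = -(2πw̄)²
e^{2πi w̄ t}`, so `φ = A cos ωt - B sin ωt + C e^{2πi w̄ t}` with `ω = √(2c₂/c₁)`. Differentiating
loses a constant and a multiple of `t`; restoring these two conditions determines `A` and `B`. The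
resulting `φ` is checked directly in `kernelSymbolFun_integral_equation`, and its transform is the
stated formula (`pwTransform_kernelSymbol`), with `q`, `-r` and the sinc quotient as the transforms
of cosine, sine and exponential. The exceptional points are the resonances `2πw̄ = ±ω` and `2πz =
±ω`; there the formula is recovered from the joint continuity of the kernel
(`continuous_repKernel`).

The Paley–Wiener theorem is proved through orthogonality. A contour integral shows that an `L²`
function of type `2πb` is orthogonal to the transforms of all modulations of a function that is
nonzero precisely on `(b, ∞)`. Its inverse transform therefore vanishes beyond `b`, and by
reflection below `-b`. -/

theorem continuous_fourier_of_integrable {φ : ℝ → ℂ} (hφ : Integrable φ) : Continuous (𝓕 φ) :=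
  VectorFourier.fourierIntegral_continuous Real.continuous_fourierChar (by fun_prop) hφ

theorem norm_fourier_le_integral_norm (φ : ℝ → ℂ) (x : ℝ) : ‖𝓕 φ x‖ ≤ ∫ t, ‖φ t‖ :=
  VectorFourier.norm_fourierIntegral_le_integral_norm _ _ _ _ _

open scoped ContDiff in
/-- On `L¹ ∩ L²`, the `L²` Fourier transform is given by the Fourier integral. -/
theorem fourier_toLp_ae_eq {φ : ℝ → ℂ} (h1 : Integrable φ) (h2 : MemLp φ 2) :
    ((𝓕 (h2.toLp φ) : Lp ℂ 2 (volume : Measure ℝ)) : ℝ → ℂ) =ᵐ[volume] 𝓕 φ := by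
  -- Both sides are tested against smooth compactly supported functions. The `L²` transform is
  -- compatible with that of tempered distributions, so on either side the transform can be moved
  -- onto the test function.
  refine ae_eq_of_integral_contDiff_smul_eq
    ((Lp.memLp _).locallyIntegrable (by norm_num))
    (continuous_fourier_of_integrable h1).locallyIntegrable fun g g_smooth g_cpt => ?_
  have hg₁ : HasCompactSupport (Complex.ofRealCLM ∘ g) := g_cpt.comp_left rfl
  have hg₂ : ContDiff ℝ ∞ (Complex.ofRealCLM ∘ g) := by fun_prop
  set G := hg₁.toSchwartzMap hg₂ with hG
  have key := congrArg (fun T => T G) (Lp.fourier_toTemperedDistribution_eq (h2.toLp φ))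
  simp only [TemperedDistribution.fourier_apply, Lp.toTemperedDistribution_apply] at key
  have hl : ∫ x, (𝓕 G) x • (h2.toLp φ) x = ∫ x, (𝓕 (G : ℝ → ℂ)) x • φ x := by
    refine integral_congr_ae ?_
    filter_upwards [h2.coeFn_toLp] with x hx
    rw [hx, SchwartzMap.fourier_coe]
  have hflip : ∫ x, (𝓕 (G : ℝ → ℂ)) x • φ x = ∫ x, G x • (𝓕 φ) x := by
    simpa using! VectorFourier.integral_fourierIntegral_smul_eq_flip (L := innerₗ ℝ)
      Real.continuous_fourierChar continuous_inner G.integrable h1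
  rw [hl, hflip] at key
  have e : ∀ (u : ℝ → ℂ), ∫ x, g x • u x = ∫ x, G x • u x := fun u => by
    congr 1
  rw [e, e, key]

theorem memLp_fourier {φ : ℝ → ℂ} (h1 : Integrable φ) (h2 : MemLp φ 2) : MemLp (𝓕 φ) 2 :=
  (memLp_congr_ae (fourier_toLp_ae_eq h1 h2)).1 (Lp.memLp _)

theorem inner_Lp_eq_integral {f g : ℝ → ℂ} {F G : Lp ℂ 2 (volume : Measure ℝ)}
    (hf : F =ᵐ[volume] f) (hg : G =ᵐ[volume] g) :
    inner ℂ F G = ∫ x, conj (f x) * g x := by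
  rw [L2.inner_def]
  refine integral_congr_ae ?_
  filter_upwards [hf, hg] with x h1 h2
  rw [h1, h2, RCLike.inner_apply, mul_comm]

/-- Plancherel's theorem on `L¹ ∩ L²`. -/
theorem integral_conj_fourier_mul_fourier {φ ψ : ℝ → ℂ} (h1 : Integrable φ) (h2 : MemLp φ 2)
    (k1 : Integrable ψ) (k2 : MemLp ψ 2) :
    ∫ x, conj (𝓕 φ x) * 𝓕 ψ x = ∫ t, conj (φ t) * ψ t := by
  rw [← inner_Lp_eq_integral (fourier_toLp_ae_eq h1 h2) (fourier_toLp_ae_eq k1 k2),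
    Lp.inner_fourier_eq, inner_Lp_eq_integral h2.coeFn_toLp k2.coeFn_toLp]

theorem integral_norm_sq_fourier {φ : ℝ → ℂ} (h1 : Integrable φ) (h2 : MemLp φ 2) :
    ∫ x, ‖𝓕 φ x‖ ^ 2 = ∫ t, ‖φ t‖ ^ 2 := by
  have h := integral_conj_fourier_mul_fourier h1 h2 h1 h2
  simp only [Complex.conj_mul', ← Complex.ofReal_pow] at h
  rw [integral_complex_ofReal, integral_complex_ofReal] at h
  exact_mod_cast h

theorem ae_eq_zero_of_fourier_eq_zero {φ : ℝ → ℂ} (h1 : Integrable φ) (h2 : MemLp φ 2)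
    (h : ∀ x, 𝓕 φ x = 0) : φ =ᵐ[volume] 0 := by
  have h0 : (𝓕 (h2.toLp φ) : Lp ℂ 2 (volume : Measure ℝ)) = 0 := by
    rw [Lp.eq_zero_iff_ae_eq_zero]
    filter_upwards [fourier_toLp_ae_eq h1 h2] with x hx
    rw [hx, h, Pi.zero_apply]
  have h3 : h2.toLp φ = 0 := by
    rw [← norm_eq_zero, ← Lp.norm_fourier_eq, h0, norm_zero]
  filter_upwards [h2.coeFn_toLp, Lp.eq_zero_iff_ae_eq_zero.1 h3] with x hx hx'
  rw [← hx, hx']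

/-- A function in `L²` which is orthogonal to the Fourier transforms of all modulations of `k`
has a Fourier transform which vanishes wherever `k` does not. -/
theorem fourierInv_eq_zero_of_integral_eq_zero (f : Lp ℂ 2 (volume : Measure ℝ)) {k : ℝ → ℂ}
    (k1 : Integrable k) (k2 : MemLp k 2) {C : ℝ} (kC : ∀ t, ‖k t‖ ≤ C)
    (h : ∀ s : ℝ, ∫ x, conj (𝓕 k (x - s)) * f x = 0) :
    ∀ᵐ t, k t ≠ 0 → (𝓕⁻ f : Lp ℂ 2 (volume : Measure ℝ)) t = 0 := by
  set F : Lp ℂ 2 (volume : Measure ℝ) := 𝓕⁻ f with hF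
  have hFf : 𝓕 F = f := FourierTransform.fourier_fourierInv_eq f
  have m1 : Integrable (fun t => conj (k t) * F t) := k2.star.integrable_mul (Lp.memLp F)
  have m2 : MemLp (fun t => conj (k t) * F t) 2 := by
    refine (Lp.memLp F).of_le_mul (c := C) ?_ (ae_of_all _ fun t => ?_)
    · exact (k2.star.aestronglyMeasurable).mul (Lp.aestronglyMeasurable F)
    · rw [norm_mul, RCLike.norm_conj]
      exact mul_le_mul_of_nonneg_right (kC t) (norm_nonneg _)
  -- By Plancherel, the vanishing integral with parameter `s` is the Fourier transform of `conj k ·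
  -- F` at `s`, since modulating `k` by `s` translates `𝓕 k` by `s`.
  have hz : ∀ s, 𝓕 (fun t => conj (k t) * F t) s = 0 := by
    intro s
    let e : ℝ → ℂ := fun t => Real.fourierChar (s * t)
    have he : ∀ t, ‖e t‖ = 1 := fun t => Circle.norm_coe _
    have ec : Continuous e := by fun_prop
    have n1 : Integrable (fun t => e t * k t) :=
      k1.bdd_mul (c := 1) ec.aestronglyMeasurable (ae_of_all _ fun t => (he t).le)
    have n2 : MemLp (fun t => e t * k t) 2 := by
      refine k2.of_le_mul (c := 1) (ec.aestronglyMeasurable.mul k2.aestronglyMeasurable)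
        (ae_of_all _ fun t => ?_)
      rw [norm_mul, he]
    have tr : ∀ x, 𝓕 (fun t => e t * k t) x = 𝓕 k (x - s) := by
      intro x
      rw [Real.fourier_real_eq, Real.fourier_real_eq]
      refine integral_congr_ae (ae_of_all _ fun t => ?_)
      simp only [e, Circle.smul_def, smul_eq_mul]
      rw [← mul_assoc, ← Circle.coe_mul, ← AddChar.map_add_eq_mul]
      congr 3
      ring
    have := inner_Lp_eq_integral (fourier_toLp_ae_eq n1 n2) (Filter.EventuallyEq.refl _ f)
    simp only [tr, h s] at this
    rw [← hFf, Lp.inner_fourier_eq,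
      inner_Lp_eq_integral n2.coeFn_toLp (Filter.EventuallyEq.refl _ F)] at this
    rw [Real.fourier_real_eq, ← this]
    refine integral_congr_ae (ae_of_all _ fun t => ?_)
    simp only [e, Circle.smul_def, smul_eq_mul, map_mul]
    rw [← Circle.coe_inv_eq_conj, ← AddChar.map_neg_eq_inv, mul_assoc]
    congr 3
    ring
  filter_upwards [ae_eq_zero_of_fourier_eq_zero m1 m2 hz] with t ht hk
  simpa [hk] using ht

/-! ### Entire functions of exponential type -/

theorem ExpTypeLE.comp_add_real {τ : ℝ} {f : ℂ → ℂ} (hf : ExpTypeLE τ f) (s : ℝ) :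
    ExpTypeLE τ fun z => f (z + s) := by
  intro ε hε
  obtain ⟨C, hC⟩ := hf ε hε
  have hC0 : 0 ≤ C := by
    have := (norm_nonneg _).trans (hC 0)
    exact nonneg_of_mul_nonneg_left this (Real.exp_pos _)
  refine ⟨C * Real.exp (|τ + ε| * |s|), fun z => (hC _).trans ?_⟩
  rw [mul_assoc, ← Real.exp_add]
  refine mul_le_mul_of_nonneg_left (Real.exp_le_exp.2 ?_) hC0
  have h1 : |‖z + s‖ - ‖z‖| ≤ |s| := by
    have := abs_norm_sub_norm_le (z + s) z
    simpa using this
  have h2 : (τ + ε) * (‖z + s‖ - ‖z‖) ≤ |τ + ε| * |s| :=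
    (le_abs_self _).trans (by rw [abs_mul]; exact mul_le_mul_of_nonneg_left h1 (abs_nonneg _))
  linarith

theorem ExpTypeLE.comp_neg {τ : ℝ} {f : ℂ → ℂ} (hf : ExpTypeLE τ f) :
    ExpTypeLE τ fun z => f (-z) := by
  intro ε hε
  obtain ⟨C, hC⟩ := hf ε hε
  exact ⟨C, fun z => by simpa using hC (-z)⟩

/-- The Phragmén–Lindelöf bound in the upper half plane for a function of exponential type which
is bounded on the real line. -/
theorem ExpTypeLE.norm_le_of_im_nonneg {τ M : ℝ} {G : ℂ → ℂ} (hd : Differentiable ℂ G)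
    (ht : ExpTypeLE τ G) (hM : ∀ x : ℝ, ‖G x‖ ≤ M) {z : ℂ} (hz : 0 ≤ z.im) :
    ‖G z‖ ≤ M * Real.exp (τ * z.im) := by
  have key : ∀ ε : ℝ, 0 < ε → ‖G z‖ ≤ M * Real.exp ((τ + ε) * z.im) := by
    intro ε hε
    obtain ⟨C, hC⟩ := ht ε hε
    have hC0 : 0 ≤ C := by
      have := (norm_nonneg _).trans (hC 0)
      exact nonneg_of_mul_nonneg_left this (Real.exp_pos _)
    -- Rotated to the right half plane and damped: the type bound makes `g` bounded on the positive
    -- axis, `hM` bounds it by `M` on the imaginary axis, and its growth has order 1, below the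
    -- critical order 2.
    let g : ℂ → ℂ := fun ζ => G (Complex.I * ζ) * Complex.exp (-((τ + ε : ℝ) : ℂ) * ζ)
    have hgn : ∀ ζ, ‖g ζ‖ = ‖G (Complex.I * ζ)‖ * Real.exp (-(τ + ε) * ζ.re) := by
      intro ζ
      rw [norm_mul, Complex.norm_exp]
      congr 2
      rw [← Complex.ofReal_neg, Complex.re_ofReal_mul]
    have hgd : Differentiable ℂ g := by
      refine (hd.comp (differentiable_id.const_mul Complex.I)).mul ?_
      exact (differentiable_id.const_mul _).cexp
    have hbound : ∀ ζ : ℂ, ‖g ζ‖ ≤ C * Real.exp ((τ + ε) * ‖ζ‖ - (τ + ε) * ζ.re) := by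
      intro ζ
      rw [hgn, sub_eq_add_neg, Real.exp_add, ← mul_assoc, neg_mul]
      refine mul_le_mul_of_nonneg_right ?_ (Real.exp_pos _).le
      simpa using hC (Complex.I * ζ)
    have main : ‖g (-Complex.I * z)‖ ≤ M := by
      refine PhragmenLindelof.right_half_plane_of_bounded_on_real hgd.diffContOnCl
        ⟨1, by norm_num, 2 * |τ + ε|, ?_⟩ ?_ ?_ ?_
      · refine Asymptotics.IsBigO.of_bound C (Eventually.of_forall fun ζ => (hbound ζ).trans ?_)
        rw [Real.norm_of_nonneg (Real.exp_pos _).le, Real.rpow_one]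
        refine mul_le_mul_of_nonneg_left (Real.exp_le_exp.2 ?_) hC0
        have h1 : (τ + ε) * (‖ζ‖ - ζ.re) ≤ |τ + ε| * |‖ζ‖ - ζ.re| := by
          rw [← abs_mul]; exact le_abs_self _
        have h2 : |‖ζ‖ - ζ.re| ≤ 2 * ‖ζ‖ := by
          have := Complex.abs_re_le_norm ζ
          rw [abs_le] at this ⊢
          constructor <;> linarith [norm_nonneg ζ]
        have h3 := mul_le_mul_of_nonneg_left h2 (abs_nonneg (τ + ε))
        linarith
      · refine isBoundedUnder_of_eventually_le (a := C) ?_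
        filter_upwards [eventually_ge_atTop (0 : ℝ)] with x hx
        refine (hbound x).trans ?_
        simp [abs_of_nonneg hx]
      · intro x
        rw [hgn]
        have : Complex.I * (x * Complex.I) = ((-x : ℝ) : ℂ) := by
          linear_combination (x : ℂ) * Complex.I_mul_I + (by push_cast; ring : (-x : ℂ) = ((-x : ℝ) : ℂ))
        rw [this]
        simpa using hM (-x)
      · simpa using hz
    rw [hgn] at main
    have e1 : Complex.I * (-Complex.I * z) = z := by
      linear_combination -z * Complex.I_mul_I
    have e2 : (-Complex.I * z).re = z.im := by simp
    rw [e1, e2, neg_mul, Real.exp_neg, ← div_eq_mul_inv, div_le_iff₀ (Real.exp_pos _)] at main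
    exact main
  have hc : Tendsto (fun ε : ℝ => M * Real.exp ((τ + ε) * z.im)) (𝓝[>] 0)
      (𝓝 (M * Real.exp ((τ + 0) * z.im))) :=
    (Continuous.tendsto (by fun_prop) 0).mono_left nhdsWithin_le_nhds
  rw [add_zero] at hc
  exact ge_of_tendsto hc (eventually_nhdsWithin_of_forall fun ε hε => key ε hε)

/-! ### Orthogonality of functions of exponential type to half-plane kernels. -/

theorem norm_real_add_I_sq (x : ℝ) : ‖((x : ℂ) + Complex.I) ^ 2‖ = 1 + x ^ 2 := by
  rw [norm_pow, ← Complex.normSq_eq_norm_sq, Complex.normSq_apply]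
  simp
  ring

theorem add_I_ne_zero_of_im_nonneg {z : ℂ} (hz : 0 ≤ z.im) : z + Complex.I ≠ 0 := by
  intro h
  have := congrArg Complex.im h
  simp at this
  linarith

/-- A bounded holomorphic function in the upper half plane is orthogonal to `(x + i)⁻²`. -/
theorem integral_div_add_I_sq_eq_zero {W : ℂ → ℂ} (hd : Differentiable ℂ W) {M : ℝ}
    (hM : ∀ z : ℂ, 0 ≤ z.im → ‖W z‖ ≤ M) :
    ∫ x : ℝ, W x / ((x : ℂ) + Complex.I) ^ 2 = 0 := by
  have hM0 : 0 ≤ M := (norm_nonneg _).trans (hM 0 (by simp))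
  let g : ℂ → ℂ := fun z => W z / (z + Complex.I) ^ 2
  have hint : Integrable fun x : ℝ => g x := by
    refine (integrable_inv_one_add_sq.const_mul M).mono' ?_ (ae_of_all _ fun x => ?_)
    · refine Continuous.aestronglyMeasurable ?_
      refine (hd.continuous.comp Complex.continuous_ofReal).div (by fun_prop) fun x => ?_
      exact pow_ne_zero 2 (add_I_ne_zero_of_im_nonneg (by simp))
    · rw [norm_div, norm_real_add_I_sq, div_eq_mul_inv]
      exact mul_le_mul_of_nonneg_right (hM x (by simp)) (by positivity)
  have hlim := intervalIntegral_tendsto_integral hint tendsto_neg_atTop_atBot tendsto_id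
  have hgb : ∀ R : ℝ, 0 < R → ∀ z : ℂ, 0 ≤ z.im → R ≤ ‖z + Complex.I‖ → ‖g z‖ ≤ M / R ^ 2 := by
    intro R hR z hz hzR
    rw [norm_div, norm_pow]
    exact div_le_div₀ hM0 (hM z hz) (by positivity) (pow_le_pow_left₀ hR.le hzR 2)
  -- Cauchy on the rectangle `[-R, R] × [0, R]`: the other three sides have total length `4R`, and
  -- the integrand there is at most `M / R²`.
  have hbound : ∀ R : ℝ, 0 < R → ‖∫ x in (-R)..R, g x‖ ≤ 4 * M / R := by
    intro R hR
    have hrect := Complex.integral_boundary_rect_eq_zero_of_differentiableOn g (-R : ℝ)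
      ((R : ℝ) + (R : ℝ) * Complex.I) (by
        refine fun z hz => DifferentiableAt.differentiableWithinAt ?_
        have him : 0 ≤ z.im := by
          have := hz.2
          simp [Set.uIcc_of_le hR.le] at this
          exact this.1
        exact (hd z).div (by fun_prop) (pow_ne_zero 2 (add_I_ne_zero_of_im_nonneg him)))
    simp only [Complex.ofReal_re, Complex.ofReal_im, Complex.add_re, Complex.add_im,
      Complex.mul_re, Complex.mul_im, Complex.I_re, Complex.I_im, mul_zero, mul_one, zero_mul,
      sub_zero, add_zero, zero_add, Complex.ofReal_zero] at hrect
    have b1 : ‖∫ x in (-R)..R, g (x + R * Complex.I)‖ ≤ M / R ^ 2 * |R - (-R)| := by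
      refine intervalIntegral.norm_integral_le_of_norm_le_const fun x _ => ?_
      refine hgb R hR _ (by simp [hR.le]) ?_
      refine le_trans ?_ (Complex.abs_im_le_norm _)
      refine le_trans ?_ (le_abs_self _)
      simp
    have b2 : ∀ c : ℝ, |c| = R → ‖∫ y in (0:ℝ)..R, g (c + y * Complex.I)‖ ≤ M / R ^ 2 * |R - 0| := by
      intro c hc
      refine intervalIntegral.norm_integral_le_of_norm_le_const fun y hy => ?_
      rw [Set.uIoc_of_le hR.le] at hy
      refine hgb R hR _ (by simp [hy.1.le]) ?_
      refine le_trans ?_ (Complex.abs_re_le_norm _)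
      simp [hc]
    have b3 := b2 R (abs_of_pos hR)
    have b4 := b2 (-R) (by rw [abs_neg, abs_of_pos hR])
    have e : ∫ x in (-R)..R, g x = (∫ x in (-R)..R, g (x + R * Complex.I)) -
        Complex.I • (∫ y in (0:ℝ)..R, g (R + y * Complex.I)) +
        Complex.I • ∫ y in (0:ℝ)..R, g ((-R : ℝ) + y * Complex.I) := by
      linear_combination hrect
    rw [e]
    refine (norm_add_le _ _).trans ((add_le_add_left (norm_sub_le _ _) _).trans ?_)
    rw [norm_smul, norm_smul, Complex.norm_I, one_mul, one_mul]
    have hs : M / R ^ 2 * |R - (-R)| + M / R ^ 2 * |R - 0| + M / R ^ 2 * |R - 0| = 4 * M / R := by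
      rw [sub_neg_eq_add, sub_zero, abs_of_pos hR, abs_of_pos (by linarith)]
      field_simp
      ring
    linarith
  have hzero : Tendsto (fun R : ℝ => ∫ x in (-R)..R, g x) atTop (𝓝 0) := by
    refine squeeze_zero_norm' ?_ (tendsto_const_nhds.div_atTop tendsto_id : Tendsto
      (fun R : ℝ => 4 * M / R) atTop (𝓝 0))
    filter_upwards [eventually_gt_atTop 0] with R hR using hbound R hR
  exact tendsto_nhds_unique hlim hzero

theorem memLp_two_of_integrable_of_norm_le {φ : ℝ → ℂ} (h : Integrable φ) {C : ℝ}
    (hC : ∀ t, ‖φ t‖ ≤ C) : MemLp φ 2 := by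
  rw [memLp_two_iff_integrable_sq_norm h.aestronglyMeasurable]
  refine (h.norm.const_mul C).mono' (h.aestronglyMeasurable.norm.pow 2) (ae_of_all _ fun t => ?_)
  rw [Real.norm_of_nonneg (by positivity), sq]
  exact mul_le_mul_of_nonneg_right (hC t) (norm_nonneg _)

theorem memLp_inv_one_add_sq : MemLp (fun x : ℝ => (((1 + x ^ 2)⁻¹ : ℝ) : ℂ)) 2 := by
  refine memLp_two_of_integrable_of_norm_le (C := 1) integrable_inv_one_add_sq.ofReal fun t => ?_
  rw [Complex.norm_real, Real.norm_of_nonneg (by positivity)]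
  exact inv_le_one_of_one_le₀ (by nlinarith [sq_nonneg t])

/-- The function `x ↦ e^{iτx} / (x + i)²`. -/
def halfPlaneKernel (τ : ℝ) (x : ℝ) : ℂ :=
  Complex.exp (Complex.I * τ * x) / ((x : ℂ) + Complex.I) ^ 2

theorem continuous_halfPlaneKernel (τ : ℝ) : Continuous (halfPlaneKernel τ) := by
  refine Continuous.div (by fun_prop) (by fun_prop) fun x => ?_
  exact pow_ne_zero 2 (add_I_ne_zero_of_im_nonneg (by simp))

theorem norm_halfPlaneKernel (τ x : ℝ) : ‖halfPlaneKernel τ x‖ = (1 + x ^ 2)⁻¹ := by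
  have : Complex.I * τ * x = ((τ * x : ℝ) : ℂ) * Complex.I := by push_cast; ring
  rw [halfPlaneKernel, norm_div, norm_real_add_I_sq, this, Complex.norm_exp_ofReal_mul_I, one_div]

/-- From `|u| ≤ 1 + |u|²`. The bound is uniform in `x`: averaging makes an `L²` function bounded on
the real line, which is what Phragmén–Lindelöf requires. -/
theorem norm_integral_le_of_integrable_sq {f : ℂ → ℂ} (hd : Differentiable ℂ f)
    (h2 : MemLp (fun x : ℝ => f x) 2) (x : ℝ) {η : ℝ} (hη : 0 ≤ η) :
    ‖∫ s in (0:ℝ)..η, f (x + s)‖ ≤ η + ∫ y : ℝ, ‖f y‖ ^ 2 := by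
  have hc : Continuous fun s : ℝ => f (x + s) := hd.continuous.comp (by fun_prop)
  have hsq : Integrable fun s : ℝ => ‖f (x + s)‖ ^ 2 := by
    have := ((memLp_two_iff_integrable_sq_norm h2.aestronglyMeasurable).1 h2).comp_add_left x
    simpa using this
  calc ‖∫ s in (0:ℝ)..η, f (x + s)‖ ≤ ∫ s in (0:ℝ)..η, ‖f (x + s)‖ :=
        intervalIntegral.norm_integral_le_integral_norm hη
    _ ≤ ∫ s in (0:ℝ)..η, (1 + ‖f (x + s)‖ ^ 2) := by
        refine intervalIntegral.integral_mono_on hη (hc.norm.intervalIntegrable _ _)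
          ((continuous_const.add (hc.norm.pow 2)).intervalIntegrable _ _) fun s _ => ?_
        nlinarith [sq_nonneg (‖f (x + s)‖ - 1), sq_nonneg (‖f (x + s)‖)]
    _ = η + ∫ s in (0:ℝ)..η, ‖f (x + s)‖ ^ 2 := by
        have hi : IntervalIntegrable (fun s : ℝ => ‖f (x + s)‖ ^ 2) volume 0 η :=
          (hc.norm.pow 2).intervalIntegrable _ _
        rw [intervalIntegral.integral_add (by simp) hi]
        simp
    _ ≤ η + ∫ s : ℝ, ‖f (x + s)‖ ^ 2 := by
        rw [intervalIntegral.integral_of_le hη]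
        exact add_le_add_right (setIntegral_le_integral hsq (ae_of_all _ fun s => by positivity)) _
    _ = η + ∫ y : ℝ, ‖f y‖ ^ 2 := by
        congr 1
        have := integral_add_left_eq_self (μ := volume) (fun y : ℝ => ‖f y‖ ^ 2) x
        simpa using this

/-- The averaged version of `integral_mul_halfPlaneKernel_eq_zero`. -/
theorem integral_average_mul_halfPlaneKernel {τ : ℝ} {f : ℂ → ℂ} (hd : Differentiable ℂ f)
    (ht : ExpTypeLE τ f) (h2 : MemLp (fun x : ℝ => f x) 2) {η : ℝ} (hη : 0 ≤ η) :
    ∫ x : ℝ, (∫ s in (0:ℝ)..η, f (x + s)) * halfPlaneKernel τ x = 0 := by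
  -- With a primitive `Φ`, the average is `Φ (z + η) - Φ z`, hence again entire and of the same
  -- type.
  obtain ⟨Φ, hΦ⟩ := hd.isExactOn_univ
  have hΦ' : ∀ z, HasDerivAt Φ (f z) z := fun z => hΦ z (Set.mem_univ z)
  let G : ℂ → ℂ := fun z => Φ (z + η) - Φ z
  have hG : ∀ z : ℂ, ∫ s in (0:ℝ)..η, f (z + s) = G z := by
    intro z
    have hder : ∀ s : ℝ, HasDerivAt (fun s : ℝ => Φ (z + s)) (f (z + s)) s := by
      intro s
      have h1 : HasDerivAt (fun s : ℝ => z + (s : ℂ)) 1 s :=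
        (Complex.ofRealCLM.hasDerivAt (x := s)).const_add z
      simpa using! HasDerivAt.comp s (hΦ' (z + s)) h1
    rw [intervalIntegral.integral_eq_sub_of_hasDerivAt (fun s _ => hder s)]
    · simp [G]
    · exact (hd.continuous.comp (by fun_prop)).intervalIntegrable _ _
  have hGd : Differentiable ℂ G := by
    have hΦd : Differentiable ℂ Φ := fun z => (hΦ' z).differentiableAt
    exact (hΦd.comp (differentiable_id.add_const _)).sub hΦd
  have hGt : ExpTypeLE τ G := by
    intro ε hε
    obtain ⟨C, hC⟩ := ht ε hε
    have hC0 : 0 ≤ C := by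
      have := (norm_nonneg _).trans (hC 0)
      exact nonneg_of_mul_nonneg_left this (Real.exp_pos _)
    refine ⟨C * Real.exp (|τ + ε| * η) * η, fun z => ?_⟩
    rw [← hG z]
    have : ∀ s ∈ Set.uIoc 0 η, ‖f (z + s)‖ ≤
        C * Real.exp (|τ + ε| * η) * Real.exp ((τ + ε) * ‖z‖) := by
      intro s hs
      rw [Set.uIoc_of_le hη] at hs
      refine (hC _).trans ?_
      rw [mul_assoc, ← Real.exp_add]
      refine mul_le_mul_of_nonneg_left (Real.exp_le_exp.2 ?_) hC0
      have h1 : |‖z + s‖ - ‖z‖| ≤ η := by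
        refine (abs_norm_sub_norm_le (z + s) z).trans ?_
        simpa [abs_of_pos hs.1] using hs.2
      have h2 : (τ + ε) * (‖z + s‖ - ‖z‖) ≤ |τ + ε| * η :=
        (le_abs_self _).trans (by rw [abs_mul]; exact mul_le_mul_of_nonneg_left h1 (abs_nonneg _))
      linarith
    refine (intervalIntegral.norm_integral_le_of_norm_le_const this).trans (le_of_eq ?_)
    rw [sub_zero, abs_of_nonneg hη]
    ring
  have hGM : ∀ x : ℝ, ‖G x‖ ≤ η + ∫ y : ℝ, ‖f y‖ ^ 2 := fun x => by
    rw [← hG x]; exact norm_integral_le_of_integrable_sq hd h2 x hη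
  have := integral_div_add_I_sq_eq_zero (W := fun z => G z * Complex.exp (Complex.I * τ * z))
    (hGd.mul (differentiable_id.const_mul _).cexp) (M := η + ∫ y : ℝ, ‖f y‖ ^ 2) (by
      intro z hz
      have h1 := hGt.norm_le_of_im_nonneg hGd hGM hz
      have h3 : (Complex.I * τ * z).re = -(τ * z.im) := by simp
      rw [norm_mul, Complex.norm_exp, h3, Real.exp_neg, ← div_eq_mul_inv,
        div_le_iff₀ (Real.exp_pos _)]
      exact h1)
  rw [← this]
  refine integral_congr_ae (ae_of_all _ fun x => ?_)
  simp only [hG x, halfPlaneKernel]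
  ring

theorem integrable_sq_comp_add {f : ℂ → ℂ} (h2 : MemLp (fun x : ℝ => f x) 2) (s : ℝ) :
    Integrable fun x : ℝ => ‖f (x + s)‖ ^ 2 := by
  have := ((memLp_two_iff_integrable_sq_norm h2.aestronglyMeasurable).1 h2).comp_add_right s
  simpa using this

/-- The translation is moved from `f` to the explicit kernel, where dominated convergence applies
through `1 + x² ≤ 2 (1 + s²)(1 + (x - s)²)`. -/
theorem continuous_integral_mul_halfPlaneKernel {τ : ℝ} {f : ℂ → ℂ} (hd : Differentiable ℂ f)
    (h2 : MemLp (fun x : ℝ => f x) 2) :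
    Continuous fun s : ℝ => ∫ x : ℝ, f (x + s) * halfPlaneKernel τ x := by
  have e : (fun s : ℝ => ∫ x : ℝ, f (x + s) * halfPlaneKernel τ x) =
      fun s : ℝ => ∫ x : ℝ, f x * halfPlaneKernel τ (x - s) := by
    funext s
    rw [← integral_add_right_eq_self (fun x : ℝ => f x * halfPlaneKernel τ (x - s)) s]
    simp
  rw [e, continuous_iff_continuousAt]
  intro s₀
  have hfc : Continuous fun x : ℝ => f x := hd.continuous.comp Complex.continuous_ofReal
  refine continuousAt_of_dominated (bound := fun x => (2 * (1 + (|s₀| + 1) ^ 2)) *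
    ‖f x * (((1 + x ^ 2)⁻¹ : ℝ) : ℂ)‖) ?_ ?_ ?_ ?_
  · refine Eventually.of_forall fun s => Continuous.aestronglyMeasurable ?_
    exact hfc.mul ((continuous_halfPlaneKernel τ).comp (by fun_prop))
  · filter_upwards [Metric.ball_mem_nhds s₀ one_pos] with s hs
    refine ae_of_all _ fun x => ?_
    rw [norm_mul, norm_mul, norm_halfPlaneKernel, Complex.norm_real,
      Real.norm_of_nonneg (by positivity), mul_left_comm]
    refine mul_le_mul_of_nonneg_left ?_ (norm_nonneg _)
    have hs1 : |s| ≤ |s₀| + 1 := by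
      rw [Metric.mem_ball, Real.dist_eq] at hs
      have := abs_sub_abs_le_abs_sub s s₀
      linarith
    have hs2 : s ^ 2 ≤ (|s₀| + 1) ^ 2 := by
      rw [← sq_abs s]; exact pow_le_pow_left₀ (abs_nonneg _) hs1 2
    rw [inv_eq_one_div, ← div_eq_mul_inv, div_le_div_iff₀ (by positivity) (by positivity)]
    nlinarith [sq_nonneg (x - 2 * s), sq_nonneg (x - s), sq_nonneg s,
      mul_nonneg (sub_nonneg.2 hs2) (sq_nonneg (x - s)), mul_nonneg (sq_nonneg s) (sq_nonneg (x - s))]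
  · exact (h2.integrable_mul memLp_inv_one_add_sq).norm.const_mul _
  · refine ae_of_all _ fun x => Continuous.continuousAt ?_
    exact continuous_const.mul ((continuous_halfPlaneKernel τ).comp (by fun_prop))

/-- A function of exponential type at most `τ` in `L²` is orthogonal to `e^{-iτx} / (x - i)²`. -/
theorem integral_mul_halfPlaneKernel_eq_zero {τ : ℝ} {f : ℂ → ℂ} (hd : Differentiable ℂ f)
    (ht : ExpTypeLE τ f) (h2 : MemLp (fun x : ℝ => f x) 2) :
    ∫ x : ℝ, f x * halfPlaneKernel τ x = 0 := by
  set H : ℝ → ℂ := fun s : ℝ => ∫ x : ℝ, f (x + s) * halfPlaneKernel τ x with hH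
  have hHc : Continuous H := continuous_integral_mul_halfPlaneKernel hd h2
  have hH0 : ∀ η : ℝ, 0 ≤ η → ∫ s in (0:ℝ)..η, H s = 0 := by
    intro η hη
    rw [← integral_average_mul_halfPlaneKernel hd ht h2 hη, intervalIntegral.integral_of_le hη]
    simp only [intervalIntegral.integral_of_le hη, ← integral_mul_const]
    refine integral_integral_swap ?_
    have hcont : Continuous fun p : ℝ × ℝ => f (p.2 + p.1) * halfPlaneKernel τ p.2 :=
      (hd.continuous.comp (by fun_prop)).mul ((continuous_halfPlaneKernel τ).comp continuous_snd)
    have hdom : Integrable (fun p : ℝ × ℝ => ‖f (p.2 + p.1)‖ ^ 2 + (1 + p.2 ^ 2)⁻¹)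
        ((volume.restrict (Set.Ioc 0 η)).prod volume) := by
      have hc1 : Continuous fun p : ℝ × ℝ => ‖f (p.2 + p.1)‖ ^ 2 + (1 + p.2 ^ 2)⁻¹ := by
        refine ((hd.continuous.comp (by fun_prop)).norm.pow 2).add ?_
        exact Continuous.inv₀ (by fun_prop) fun p => by positivity
      refine (integrable_prod_iff hc1.aestronglyMeasurable).2 ⟨ae_of_all _ fun s => ?_, ?_⟩
      · exact (integrable_sq_comp_add h2 s).add integrable_inv_one_add_sq
      · have : ∀ s : ℝ, ∫ x : ℝ, ‖‖f (x + s)‖ ^ 2 + (1 + x ^ 2)⁻¹‖ =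
            (∫ x : ℝ, ‖f x‖ ^ 2) + ∫ x : ℝ, (1 + x ^ 2)⁻¹ := by
          intro s
          have : ∀ x : ℝ, ‖‖f (x + s)‖ ^ 2 + (1 + x ^ 2)⁻¹‖ = ‖f (x + s)‖ ^ 2 + (1 + x ^ 2)⁻¹ :=
            fun x => Real.norm_of_nonneg (by positivity)
          simp_rw [this]
          rw [integral_add (integrable_sq_comp_add h2 s) integrable_inv_one_add_sq]
          congr 1
          rw [← integral_add_right_eq_self (fun x : ℝ => ‖f x‖ ^ 2) s]
          simp
        simp_rw [this]
        exact integrable_const _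
    refine hdom.mono' hcont.aestronglyMeasurable (ae_of_all _ fun p => ?_)
    rw [Function.uncurry, norm_mul, norm_halfPlaneKernel]
    have h0 : (1 + p.2 ^ 2)⁻¹ ≤ 1 := inv_le_one_of_one_le₀ (by nlinarith [sq_nonneg p.2])
    have h1 : 0 < (1 + p.2 ^ 2)⁻¹ := by positivity
    nlinarith [sq_nonneg (‖f (p.2 + p.1)‖ - (1 + p.2 ^ 2)⁻¹), norm_nonneg (f (p.2 + p.1)),
      sq_nonneg (‖f (p.2 + p.1)‖)]
  -- The averages vanish for `η ≥ 0`, so the one-sided derivative at `0`, which is the unaveraged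
  -- integral, vanishes too.
  have hder : HasDerivWithinAt (fun η : ℝ => ∫ s in (0:ℝ)..η, H s) (H 0) (Set.Ici 0) 0 :=
    (intervalIntegral.integral_hasDerivAt_right (hHc.intervalIntegrable _ _)
      (hHc.stronglyMeasurableAtFilter _ _) hHc.continuousAt).hasDerivWithinAt
  have hder0 : HasDerivWithinAt (fun η : ℝ => ∫ s in (0:ℝ)..η, H s) 0 (Set.Ici 0) 0 :=
    (hasDerivWithinAt_const (0:ℝ) (Set.Ici 0) (0 : ℂ)).congr (fun η hη => hH0 η hη) (hH0 0 le_rfl)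
  have := (uniqueDiffOn_Ici (0:ℝ) 0 (by simp)).eq_deriv _ hder hder0
  simpa [hH] using this

/-! ### One-sided exponentials and the support of the inverse Fourier transform. -/

/-- The one-sided function whose Fourier transform is a multiple of `e^{-2πibx} / (x - i)²`. -/
def oneSidedExp (b : ℝ) : ℝ → ℂ :=
  (Set.Ioi b).indicator fun t => ((t - b) * Real.exp (-(2 * Real.pi) * (t - b)) : ℝ)

theorem norm_oneSidedExp_le (b t : ℝ) :
    ‖oneSidedExp b t‖ ≤ (Set.Ioi b).indicator (fun t => Real.exp (-Real.pi * (t - b))) t := by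
  by_cases ht : t ∈ Set.Ioi b
  · rw [oneSidedExp, Set.indicator_of_mem ht, Set.indicator_of_mem ht, Complex.norm_real]
    have h0 : 0 < t - b := sub_pos.2 ht
    rw [Real.norm_of_nonneg (by positivity)]
    -- Half of the decay rate `2π` absorbs the linear factor.
    have h1 : t - b ≤ Real.exp (Real.pi * (t - b)) := by
      have := Real.add_one_le_exp (Real.pi * (t - b))
      nlinarith [Real.pi_gt_three]
    calc _ ≤ Real.exp (Real.pi * (t - b)) * Real.exp (-(2 * Real.pi) * (t - b)) :=
          mul_le_mul_of_nonneg_right h1 (Real.exp_pos _).le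
      _ = _ := by rw [← Real.exp_add]; congr 1; ring
  · rw [oneSidedExp, Set.indicator_of_notMem ht, Set.indicator_of_notMem ht, norm_zero]

theorem norm_oneSidedExp_le_one (b t : ℝ) : ‖oneSidedExp b t‖ ≤ 1 := by
  refine (norm_oneSidedExp_le b t).trans (Set.indicator_apply_le' (fun ht => ?_) fun _ => zero_le_one)
  rw [Real.exp_le_one_iff]
  nlinarith [Real.pi_pos, Set.mem_Ioi.1 ht]

theorem integrable_oneSidedExp (b : ℝ) : Integrable (oneSidedExp b) := by
  have h : Integrable ((Set.Ioi b).indicator fun t => Real.exp (-Real.pi * (t - b))) := by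
    rw [integrable_indicator_iff measurableSet_Ioi]
    have := (exp_neg_integrableOn_Ioi b Real.pi_pos).const_mul (Real.exp (Real.pi * b))
    refine this.congr (ae_of_all _ fun t => ?_)
    simp only
    rw [← Real.exp_add]; congr 1; ring
  refine h.mono' ?_ (ae_of_all _ (norm_oneSidedExp_le b))
  refine AEStronglyMeasurable.indicator ?_ measurableSet_Ioi
  exact Continuous.aestronglyMeasurable (by fun_prop)

/-- After a shift by `b` this is the Laplace integral `∫₀^∞ u e^{au} du = 1/a²` with `a = -2π(1 +
ix) = -2πi(x - i)`; the factor `i² = -1` produces the sign. -/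
theorem fourier_oneSidedExp (b x : ℝ) :
    𝓕 (oneSidedExp b) x = -Complex.exp (-2 * Real.pi * Complex.I * b * x) /
      (2 * Real.pi * ((x : ℂ) - Complex.I)) ^ 2 := by
  set a : ℂ := -2 * Real.pi * (1 + Complex.I * x) with ha
  have hare : a.re = -2 * Real.pi := by simp [ha]
  have ha0 : a ≠ 0 := fun h => by
    rw [h] at hare
    simp [Real.pi_ne_zero] at hare
  let g : ℝ → ℂ := fun u => (u : ℂ) * Complex.exp (a * u)
  have h1 : 𝓕 (oneSidedExp b) x = ∫ t in Set.Ioi b,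
      Complex.exp (-2 * Real.pi * Complex.I * b * x) * g (t - b) := by
    rw [Real.fourier_real_eq_integral_exp_smul, ← integral_indicator measurableSet_Ioi]
    refine integral_congr_ae (ae_of_all _ fun t => ?_)
    simp only [oneSidedExp, Set.indicator_apply]
    split_ifs
    · simp only [g, smul_eq_mul, Complex.ofReal_mul, Complex.ofReal_exp]
      rw [mul_left_comm, mul_left_comm (Complex.exp _), ← Complex.exp_add, ← Complex.exp_add,
        Complex.ofReal_sub]
      congr 2
      simp only [ha]
      push_cast
      ring
    · simp
  have hgint : IntegrableOn g (Set.Ioi 0) := by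
    have := (integrable_oneSidedExp 0).norm
    have h2 : IntegrableOn (fun t => ‖oneSidedExp 0 t‖) (Set.Ioi 0) := this.integrableOn
    refine h2.mono' (Continuous.aestronglyMeasurable (by fun_prop)) ?_
    filter_upwards [ae_restrict_mem measurableSet_Ioi] with t ht
    rw [oneSidedExp, Set.indicator_of_mem ht, Complex.norm_real, norm_mul, norm_mul,
      Complex.norm_exp, Complex.norm_real, Complex.re_mul_ofReal, hare]
    simp
  have hgval : ∫ u in Set.Ioi (0:ℝ), g u = 1 / a ^ 2 := by
    have hder : ∀ u : ℝ, HasDerivAt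
        (fun u : ℝ => ((u : ℂ) / a - 1 / a ^ 2) * Complex.exp (a * u)) (g u) u := by
      intro u
      have d1 : HasDerivAt (fun u : ℝ => (u : ℂ)) 1 u := Complex.ofRealCLM.hasDerivAt (x := u)
      have d2 := ((d1.div_const a).sub_const (1 / a ^ 2)).mul (d1.const_mul a).cexp
      refine d2.congr_deriv ?_
      simp only [g]
      field_simp
      ring
    have hlim : Tendsto (fun u : ℝ => ((u : ℂ) / a - 1 / a ^ 2) * Complex.exp (a * u)) atTop
        (𝓝 0) := by
      have r1 : Tendsto (fun u : ℝ => (u : ℂ) * Complex.exp (a * u)) atTop (𝓝 0) := by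
        rw [tendsto_zero_iff_norm_tendsto_zero]
        have := Real.tendsto_pow_mul_exp_neg_atTop_nhds_zero 1
        have h2 := (this.comp (tendsto_id.const_mul_atTop (by positivity : 0 < 2 * Real.pi))).div_const
          (2 * Real.pi)
        rw [zero_div] at h2
        refine h2.congr' ?_
        filter_upwards [eventually_ge_atTop 0] with u hu
        rw [norm_mul, Complex.norm_exp, Complex.re_mul_ofReal, hare, Complex.norm_real,
          Real.norm_of_nonneg hu]
        simp only [Function.comp, id, pow_one]
        field_simp
      have r2 : Tendsto (fun u : ℝ => Complex.exp (a * u)) atTop (𝓝 0) := by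
        rw [Complex.tendsto_exp_nhds_zero_iff]
        simp only [Complex.re_mul_ofReal, hare]
        exact tendsto_id.const_mul_atTop_of_neg (by linarith [Real.pi_pos])
      have := (r1.div_const a).sub (r2.const_mul (1 / a ^ 2))
      simp only [zero_div, mul_zero, sub_zero] at this
      refine this.congr fun u => ?_
      ring
    rw [integral_Ioi_of_hasDerivAt_of_tendsto' (fun u _ => hder u) hgint hlim]
    simp
  rw [h1, integral_const_mul]
  have hshift : ∫ t in Set.Ioi b, g (t - b) = ∫ u in Set.Ioi (0:ℝ), g u := by
    have := integral_sub_right_eq_self (μ := volume) ((Set.Ioi (0:ℝ)).indicator g) b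
    rw [integral_indicator measurableSet_Ioi] at this
    rw [← this, ← integral_indicator measurableSet_Ioi]
    refine integral_congr_ae (ae_of_all _ fun t => ?_)
    simp [Set.indicator_apply, sub_pos]
  rw [hshift, hgval]
  have : a ^ 2 = -(2 * Real.pi * ((x : ℂ) - Complex.I)) ^ 2 := by
    rw [ha]
    linear_combination (4 * (Real.pi : ℂ) ^ 2 * (x ^ 2 + 1)) * Complex.I_sq
  rw [this, mul_one_div, div_neg, neg_div]

/-- Conjugation turns `(x - i)⁻²` into `(x + i)⁻²`. This converts the contour-integral orthogonality
into a statement about the Fourier side beyond `b`. -/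
theorem conj_fourier_oneSidedExp (b x : ℝ) :
    conj (𝓕 (oneSidedExp b) x) =
      -(1 / (2 * Real.pi) ^ 2) * halfPlaneKernel (2 * Real.pi * b) x := by
  rw [fourier_oneSidedExp, halfPlaneKernel]
  simp only [map_div₀, map_neg, ← Complex.exp_conj, map_mul, map_pow, map_sub, Complex.conj_ofReal,
    Complex.conj_I, map_ofNat, sub_neg_eq_add]
  have e : -2 * (Real.pi : ℂ) * -Complex.I * b * x = Complex.I * ((2 * Real.pi * b : ℝ) : ℂ) * x := by
    push_cast
    ring
  rw [e, mul_pow]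
  generalize Complex.exp (Complex.I * ((2 * Real.pi * b : ℝ) : ℂ) * x) = E
  generalize (x : ℂ) + Complex.I = y
  ring

/-- The spectral part of the Paley–Wiener theorem, on one side. -/
theorem fourierInv_eq_zero_of_expTypeLE {b : ℝ} {f : ℂ → ℂ} (hd : Differentiable ℂ f)
    (ht : ExpTypeLE (2 * Real.pi * b) f) (h2 : MemLp (fun x : ℝ => f x) 2) :
    ∀ᵐ t : ℝ, b < |t| → (𝓕⁻ (h2.toLp _) : Lp ℂ 2 (volume : Measure ℝ)) t = 0 := by
  have kb := memLp_two_of_integrable_of_norm_le (integrable_oneSidedExp b) (norm_oneSidedExp_le_one b)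
  have base : ∀ g : ℂ → ℂ, Differentiable ℂ g → ExpTypeLE (2 * Real.pi * b) g →
      MemLp (fun x : ℝ => g x) 2 → ∀ s : ℝ,
      ∫ x : ℝ, conj (𝓕 (oneSidedExp b) (x - s)) * g x = 0 := by
    intro g gd gt g2 s
    have gs2 : MemLp (fun x : ℝ => g (x + s)) 2 := by
      have := g2.comp_measurePreserving (measurePreserving_add_right volume s)
      simpa [Function.comp_def] using! this
    -- The class is invariant under real translations, so one orthogonality relation yields those
    -- for all shifts `s`.
    have h0 := integral_mul_halfPlaneKernel_eq_zero
      (f := fun z => g (z + s)) (gd.comp (differentiable_id.add_const _)) (gt.comp_add_real s) gs2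
    rw [← integral_add_right_eq_self _ s]
    simp only [add_sub_cancel_right, conj_fourier_oneSidedExp]
    have h3 : ∀ x : ℝ, -(1 / (2 * (Real.pi : ℂ)) ^ 2) * halfPlaneKernel (2 * Real.pi * b) x *
        g ((x + s : ℝ) : ℂ) = -(1 / (2 * (Real.pi : ℂ)) ^ 2) *
          (g (x + s) * halfPlaneKernel (2 * Real.pi * b) x) := fun x => by
      rw [Complex.ofReal_add]
      ring
    simp only [h3]
    rw [integral_const_mul, h0, mul_zero]
  have pos : ∀ᵐ t : ℝ, oneSidedExp b t ≠ 0 →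
      (𝓕⁻ (h2.toLp _) : Lp ℂ 2 (volume : Measure ℝ)) t = 0 := by
    refine fourierInv_eq_zero_of_integral_eq_zero _ (integrable_oneSidedExp b) kb
      (norm_oneSidedExp_le_one b) fun s => ?_
    rw [← base f hd ht h2 s]
    refine integral_congr_ae ?_
    filter_upwards [h2.coeFn_toLp] with x hx
    rw [hx]
  have neg : ∀ᵐ t : ℝ, oneSidedExp b (-t) ≠ 0 →
      (𝓕⁻ (h2.toLp _) : Lp ℂ 2 (volume : Measure ℝ)) t = 0 := by
    refine fourierInv_eq_zero_of_integral_eq_zero (k := fun t => oneSidedExp b (-t)) _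
      (integrable_oneSidedExp b).comp_neg
      (memLp_two_of_integrable_of_norm_le (integrable_oneSidedExp b).comp_neg
        fun t => norm_oneSidedExp_le_one b (-t))
      (fun t => norm_oneSidedExp_le_one b (-t)) fun s => ?_
    have fneg2 : MemLp (fun x : ℝ => f (-x)) 2 := by
      have := h2.comp_measurePreserving (Measure.measurePreserving_neg volume)
      simpa [Function.comp_def] using! this
    have hF : ∀ y, 𝓕 (fun t => oneSidedExp b (-t)) y = 𝓕 (oneSidedExp b) (-y) := by
      intro y
      rw [Real.fourier_real_eq, Real.fourier_real_eq, ← integral_neg_eq_self]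
      simp
    rw [← base (fun z => f (-z)) (hd.comp differentiable_neg) ht.comp_neg fneg2 (-s),
      ← integral_neg_eq_self (fun x : ℝ => conj (𝓕 (oneSidedExp b) (x - -s)) * f (-x))]
    refine integral_congr_ae ?_
    filter_upwards [h2.coeFn_toLp] with x hx
    rw [hx, hF]
    simp only [Complex.ofReal_neg, neg_neg]
    congr 3
    ring_nf
  have hne : ∀ t, b < t → oneSidedExp b t ≠ 0 := by
    intro t ht
    rw [oneSidedExp, Set.indicator_of_mem (by exact ht)]
    exact_mod_cast (mul_pos (sub_pos.2 ht) (Real.exp_pos _)).ne'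
  filter_upwards [pos, neg] with t h1 h2 ht
  rcases lt_abs.1 ht with h | h
  · exact h1 (hne t h)
  · exact h2 (hne (-t) h)

/-! ### The Paley–Wiener theorem -/

/-- `φ` is square integrable and supported in `[-b, b]`. -/
structure PWSymbol (b : ℝ) (φ : ℝ → ℂ) : Prop where
  memLp : MemLp φ 2
  eq_zero : ∀ t, b < |t| → φ t = 0

/-- The Fourier–Laplace transform `∫ φ(t) e^{-2πitz} dt`. -/
def pwTransform (φ : ℝ → ℂ) (z : ℂ) : ℂ :=
  ∫ t : ℝ, φ t * Complex.exp (-2 * Real.pi * Complex.I * t * z)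

theorem pwTransform_ofReal (φ : ℝ → ℂ) (x : ℝ) : pwTransform φ x = 𝓕 φ x := by
  rw [Real.fourier_real_eq_integral_exp_smul, pwTransform]
  refine integral_congr_ae (ae_of_all _ fun t => ?_)
  simp only [smul_eq_mul]
  rw [mul_comm]
  congr 2
  push_cast
  ring

namespace PWSymbol

variable {b : ℝ} {φ ψ : ℝ → ℂ}

theorem integrable (h : PWSymbol b φ) : Integrable φ := by
  have h1 : IntegrableOn φ (Set.Icc (-b) b) :=
    (h.memLp.restrict _).integrable (by norm_num)
  refine h1.integrable_of_forall_notMem_eq_zero fun t ht => h.eq_zero t ?_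
  by_contra hc
  exact ht (abs_le.1 (not_lt.1 hc))

theorem of_bounded {C : ℝ} (hm : AEStronglyMeasurable φ) (hC : ∀ t, ‖φ t‖ ≤ C)
    (h0 : ∀ t, b < |t| → φ t = 0) : PWSymbol b φ := by
  refine ⟨memLp_two_of_integrable_of_norm_le (C := C) ?_ hC, h0⟩
  have h1 : IntegrableOn φ (Set.Icc (-b) b) :=
    Measure.integrableOn_of_bounded (M := C) (by simp) hm (ae_of_all _ hC)
  refine h1.integrable_of_forall_notMem_eq_zero fun t ht => h0 t ?_
  by_contra hc
  exact ht (abs_le.1 (not_lt.1 hc))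

theorem norm_mul_exp_le (h : PWSymbol b φ) (t : ℝ) (z : ℂ) :
    ‖φ t * Complex.exp (-2 * Real.pi * Complex.I * t * z)‖ ≤
      ‖φ t‖ * Real.exp (2 * Real.pi * b * ‖z‖) := by
  rcases lt_or_ge b |t| with ht | ht
  · simp [h.eq_zero t ht]
  · rw [norm_mul]
    refine mul_le_mul_of_nonneg_left ?_ (norm_nonneg _)
    refine (Complex.norm_exp_le_exp_norm _).trans (Real.exp_le_exp.2 ?_)
    simp only [norm_mul, norm_neg, Complex.norm_ofNat, Complex.norm_real, Complex.norm_I,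
      Real.norm_eq_abs, abs_of_pos Real.pi_pos, mul_one]
    gcongr

theorem norm_pwTransform_le (h : PWSymbol b φ) (z : ℂ) :
    ‖pwTransform φ z‖ ≤ (∫ t, ‖φ t‖) * Real.exp (2 * Real.pi * b * ‖z‖) := by
  rw [← integral_mul_const]
  exact norm_integral_le_of_norm_le (h.integrable.norm.mul_const _)
    (ae_of_all _ fun t => h.norm_mul_exp_le t z)

theorem expTypeLE (h : PWSymbol b φ) : ExpTypeLE (2 * Real.pi * b) (pwTransform φ) := by
  intro ε hε
  refine ⟨∫ t, ‖φ t‖, fun z => (h.norm_pwTransform_le z).trans ?_⟩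
  refine mul_le_mul_of_nonneg_left (Real.exp_le_exp.2 ?_) (integral_nonneg fun t => norm_nonneg _)
  nlinarith [norm_nonneg z]

theorem differentiable (h : PWSymbol b φ) : Differentiable ℂ (pwTransform φ) := by
  intro z₀
  rcases lt_or_ge b 0 with hb | hb
  · have : φ = 0 := funext fun t => h.eq_zero t (hb.trans_le (abs_nonneg t))
    have h0 : pwTransform φ = fun _ => 0 := by
      funext z
      simp [pwTransform, this]
    rw [h0]
    exact differentiableAt_const _
  have hm : ∀ z : ℂ, AEStronglyMeasurable
      (fun t : ℝ => φ t * Complex.exp (-2 * Real.pi * Complex.I * t * z)) volume := fun z =>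
    h.memLp.aestronglyMeasurable.mul (Continuous.aestronglyMeasurable (by fun_prop))
  have hint : ∀ z : ℂ, Integrable
      (fun t : ℝ => φ t * Complex.exp (-2 * Real.pi * Complex.I * t * z)) volume := fun z =>
    (h.integrable.norm.mul_const _).mono' (hm z) (ae_of_all _ fun t => h.norm_mul_exp_le t z)
  refine (hasDerivAt_integral_of_dominated_loc_of_deriv_le
    (F := fun z t => φ t * Complex.exp (-2 * Real.pi * Complex.I * t * z))
    (F' := fun z t => φ t * Complex.exp (-2 * Real.pi * Complex.I * t * z) *
      (-2 * Real.pi * Complex.I * t))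
    (bound := fun t => ‖φ t‖ * Real.exp (2 * Real.pi * b * (‖z₀‖ + 1)) * (2 * Real.pi * b))
    (Metric.ball_mem_nhds z₀ one_pos) (Eventually.of_forall hm) (hint z₀) ?_ ?_ ?_ ?_).2.differentiableAt
  · exact (hm z₀).mul (Continuous.aestronglyMeasurable (by fun_prop))
  · refine ae_of_all _ fun t z hz => ?_
    rcases lt_or_ge b |t| with ht | ht
    · simp [h.eq_zero t ht]
    · rw [norm_mul]
      have hz' : ‖z‖ ≤ ‖z₀‖ + 1 := by
        rw [Metric.mem_ball, dist_eq_norm] at hz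
        have := norm_le_norm_add_norm_sub' z z₀
        linarith
      refine mul_le_mul ((h.norm_mul_exp_le t z).trans ?_) ?_ (norm_nonneg _) (by positivity)
      · gcongr
      · simp only [norm_mul, norm_neg, Complex.norm_ofNat, Complex.norm_real, Complex.norm_I,
          Real.norm_eq_abs, abs_of_pos Real.pi_pos, mul_one]
        gcongr
  · exact (h.integrable.norm.mul_const _).mul_const _
  · refine ae_of_all _ fun t z _ => ?_
    have := ((hasDerivAt_id z).const_mul (-2 * Real.pi * Complex.I * (t : ℂ))).cexp.const_mul (φ t)
    simpa [mul_assoc] using! this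

theorem memLp_pwTransform (h : PWSymbol b φ) : MemLp (fun x : ℝ => pwTransform φ x) 2 := by
  simp only [pwTransform_ofReal]
  exact memLp_fourier h.integrable h.memLp

theorem fourier_toLp_ae_eq_pwTransform (h : PWSymbol b φ) :
    ((𝓕 (h.memLp.toLp φ) : Lp ℂ 2 (volume : Measure ℝ)) : ℝ → ℂ) =ᵐ[volume]
      fun x : ℝ => pwTransform φ x := by
  simp only [pwTransform_ofReal]
  exact fourier_toLp_ae_eq h.integrable h.memLp

end PWSymbol

/-- Two entire functions which agree almost everywhere on the real line are equal. -/
theorem eq_of_ae_eq_real {f g : ℂ → ℂ} (hf : Differentiable ℂ f) (hg : Differentiable ℂ g)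
    (h : ∀ᵐ x : ℝ, f x = g x) : f = g := by
  have hr : ∀ x : ℝ, f x = g x := by
    have := Continuous.ae_eq_iff_eq volume (hf.continuous.comp Complex.continuous_ofReal)
      (hg.continuous.comp Complex.continuous_ofReal)
    exact fun x => congrFun (this.1 h) x
  refine AnalyticOnNhd.eq_of_frequently_eq (z₀ := 0) (fun z _ => hf.analyticAt z)
    (fun z _ => hg.analyticAt z) ?_
  -- The real points `1/(n+1)` accumulate at `0`, which suffices for the identity theorem.
  have ht : Tendsto (fun n : ℕ => (((1 / ((n : ℝ) + 1) : ℝ)) : ℂ)) atTop (𝓝[≠] 0) := by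
    refine tendsto_nhdsWithin_iff.2 ⟨?_, Eventually.of_forall fun n => ?_⟩
    · have := (Complex.continuous_ofReal.tendsto 0).comp (tendsto_one_div_add_atTop_nhds_zero_nat (𝕜 := ℝ))
      simpa only [Complex.ofReal_zero] using! this
    · simp only [Set.mem_compl_iff, Set.mem_singleton_iff, Complex.ofReal_eq_zero]
      positivity
  exact ht.frequently (Frequently.of_forall fun n => hr _)

/-- The Paley–Wiener theorem. -/
theorem exists_pwTransform_eq {b : ℝ} {f : ℂ → ℂ} (hd : Differentiable ℂ f)
    (ht : ExpTypeLE (2 * Real.pi * b) f) (h2 : MemLp (fun x : ℝ => f x) 2) :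
    ∃ φ, PWSymbol b φ ∧ f = pwTransform φ := by
  set F : Lp ℂ 2 (volume : Measure ℝ) := 𝓕⁻ (h2.toLp _) with hF
  have hFF : 𝓕 F = h2.toLp _ := FourierTransform.fourier_fourierInv_eq _
  set φ : ℝ → ℂ := (Set.Icc (-b) b).indicator F with hφ
  -- Cutting off changes `F` only on a null set; it gives a representative vanishing everywhere
  -- outside `[-b, b]`.
  have hφF : φ =ᵐ[volume] F := by
    filter_upwards [fourierInv_eq_zero_of_expTypeLE hd ht h2] with t h
    by_cases htm : t ∈ Set.Icc (-b) b
    · rw [hφ, Set.indicator_of_mem htm]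
    · rw [hφ, Set.indicator_of_notMem htm, h]
      by_contra hc
      exact htm (abs_le.1 (not_lt.1 hc))
  have hs : PWSymbol b φ := by
    refine ⟨(Lp.memLp F).ae_eq hφF.symm, fun t ht => Set.indicator_of_notMem ?_ _⟩
    intro hc
    exact absurd (abs_le.2 hc) (not_le.2 ht)
  refine ⟨φ, hs, eq_of_ae_eq_real hd hs.differentiable ?_⟩
  have e : hs.memLp.toLp φ = F := by
    refine Lp.ext ?_
    exact hs.memLp.coeFn_toLp.trans hφF
  have h3 := hs.fourier_toLp_ae_eq_pwTransform
  rw [e, hFF] at h3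
  filter_upwards [h3, h2.coeFn_toLp] with x h4 h5
  rw [← h4, h5]

/-! ### The weight `ν̂` -/

/-- The left side is at most `2`. From `2.61` on the quadratic term alone exceeds `2`; below, `sin u
≥ 0.4` supplies the rest. -/
theorem one_sub_cos_le_of_two_le {u : ℝ} (h1 : 2.18 ≤ u) (h2 : u ≤ Real.pi) :
    1 - Real.cos u ≤ 0.29995 * u ^ 2 + u * Real.sin u := by
  have hs : 0 ≤ Real.sin u := Real.sin_nonneg_of_nonneg_of_le_pi (by linarith) h2
  have hc := Real.neg_one_le_cos u
  rcases le_or_gt 2.61 u with h | h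
  · nlinarith [mul_nonneg (by linarith : (0:ℝ) ≤ u) hs]
  · have hv : Real.sin u = Real.sin (Real.pi - u) := (Real.sin_pi_sub u).symm
    have hp1 := Real.pi_gt_d4
    have hp2 := Real.pi_lt_d4
    have h3 := Real.sin_ge_sub_cube (x := Real.pi - u) (by linarith)
    have h4 : (0.4 : ℝ) ≤ Real.pi - u - (Real.pi - u) ^ 3 / 6 := by
      have hv1 : 0.53 ≤ Real.pi - u := by linarith
      have hv2 : Real.pi - u ≤ 0.97 := by linarith
      generalize Real.pi - u = v at hv1 hv2
      nlinarith [mul_nonneg (sub_nonneg.2 hv1) (sub_nonneg.2 hv2), sq_nonneg v]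
    have h5 : 0.4 ≤ Real.sin u := by rw [hv]; linarith
    nlinarith

/-- Polynomial minorant of the trigonometric expression near `3π/2`, with `u = 4.712 - s`, `sin u ≈
-cos s` and `cos u ≈ -sin s` replaced by Taylor bounds. -/
theorem quintic_pos {s : ℝ} (h1 : -0.1 ≤ s) (h2 : s ≤ 1) :
    0 ≤ 0.29995 * (4.712 - s) ^ 2 - (4.712 - s) * (1 - s ^ 2 / 2 + 5 * s ^ 4 / 96) -
      (s - s ^ 3 / 6 + 5 * s ^ 4 / 96) - 1 := by
  have e : 0.29995 * (4.712 - s) ^ 2 - (4.712 - s) * (1 - s ^ 2 / 2 + 5 * s ^ 4 / 96) -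
      (s - s ^ 3 / 6 + 5 * s ^ 4 / 96) - 1 = (0.29995 * 4.712 ^ 2 - 5.712) +
      (-2 * 0.29995 * 4.712) * s + (0.29995 + 2.356) * s ^ 2 - s ^ 3 / 3
      - 5.712 * 5 / 96 * s ^ 4 + 5 / 96 * s ^ 5 := by ring
  rw [e]
  rcases le_total s 0 with h0 | h0
  · have a1 : s ^ 2 ≤ 0.01 := by nlinarith
    have a2 : s ^ 4 ≤ 0.0001 := by nlinarith [sq_nonneg s]
    have a3 : s ^ 3 ≤ 0 := by nlinarith [sq_nonneg s]
    have a5 : -0.0001 ≤ s ^ 5 := by nlinarith [sq_nonneg s, sq_nonneg (s ^ 2)]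
    nlinarith [sq_nonneg s]
  · have h3 : s ^ 3 / 3 + 5.712 * 5 / 96 * s ^ 4 - 5 / 96 * s ^ 5 ≤ 0.5792 * s ^ 3 := by
      have b1 : 0 ≤ s ^ 3 := by positivity
      have b2 : 0 ≤ (1 - s) * (0.245 - 5 / 96 * s) :=
        mul_nonneg (by linarith) (by linarith)
      nlinarith [mul_nonneg b1 b2, mul_nonneg b1 h0]
    nlinarith [mul_nonneg (sub_nonneg.2 h2) (sq_nonneg (s - 0.3)), sq_nonneg (s - 0.68),
      mul_nonneg h0 (sq_nonneg (s - 0.7)), mul_nonneg (sub_nonneg.2 h2) (sq_nonneg (s - 0.7)),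
      mul_nonneg (sub_nonneg.2 h2) (sq_nonneg (s - 0.5))]

/-- The trigonometric inequality behind the positivity of `ν̂`. -/
theorem trig_lower_bound {u : ℝ} (hu : 0 ≤ u) :
    0 ≤ 0.29995 * u ^ 2 + u * Real.sin u + Real.cos u - 1 := by
  have hp1 := Real.pi_gt_d4
  have hp2 := Real.pi_lt_d4
  -- The Taylor bounds for sine and cosine leave `u² (0.79995 - u²/6)`, which is nonnegative up to
  -- `2.18`.
  rcases le_or_gt u 2.18 with h1 | h1
  · have hs := Real.sin_ge_sub_cube hu
    have hc := Real.one_sub_sq_div_two_le_cos (x := u)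
    have h2 : u ^ 2 ≤ 2.18 ^ 2 := pow_le_pow_left₀ hu h1 2
    nlinarith [mul_le_mul_of_nonneg_left hs hu, mul_nonneg (sq_nonneg u) (sub_nonneg.2 h2)]
  rcases le_or_gt u Real.pi with h2 | h2
  · have := one_sub_cos_le_of_two_le h1.le h2
    linarith
  rcases le_or_gt u (Real.pi + 0.6) with h3 | h3
  · obtain ⟨v, rfl⟩ : ∃ v, u = v + Real.pi := ⟨u - Real.pi, by ring⟩
    have hv0 : 0 ≤ v := by linarith
    have hv1 : v ≤ 0.6 := by linarith
    rw [Real.sin_add_pi, Real.cos_add_pi]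
    have hs := Real.sin_le hv0
    have hc := (abs_le.1 (Real.cos_bound (x := v) (by rw [abs_of_nonneg hv0]; linarith))).2
    rw [abs_of_nonneg hv0] at hc
    have hv4 : v ^ 4 ≤ 0.36 * v ^ 2 := by nlinarith [sq_nonneg v, mul_nonneg hv0 (sub_nonneg.2 hv1)]
    have h5 : (v + Real.pi) * Real.sin v ≤ (v + Real.pi) * v :=
      mul_le_mul_of_nonneg_left hs (by linarith)
    nlinarith [mul_nonneg hv0 (sub_nonneg.2 hv1)]
  rcases le_or_gt u 4.8 with h4 | h4
  · obtain ⟨s, rfl⟩ : ∃ s, u = (Real.pi / 2 - s) + Real.pi := ⟨3 * Real.pi / 2 - u, by ring⟩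
    rw [Real.sin_add_pi, Real.cos_add_pi, Real.sin_pi_div_two_sub, Real.cos_pi_div_two_sub]
    have hs1 : -0.1 ≤ s := by linarith
    have hs2 : s ≤ 1 := by linarith
    have habs : |s| ≤ 1 := abs_le.2 ⟨by linarith, hs2⟩
    have h4' : |s| ^ 4 = s ^ 4 := by rw [← abs_pow, abs_of_nonneg (by positivity)]
    have hc := (abs_le.1 (Real.cos_bound habs)).2
    have hs := (abs_le.1 (Real.sin_bound habs)).2
    have h5' : |s| ^ 5 ≤ s ^ 4 := by
      rw [← h4', pow_succ]
      exact mul_le_of_le_one_right (by positivity) habs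
    rw [h4'] at hc
    have hq := quintic_pos hs1 hs2
    -- `4.712` is a rational lower approximation of `3π/2`.
    have hu : 4.712 - s ≤ Real.pi / 2 - s + Real.pi := by linarith
    have hcos : Real.cos s ≤ 1 - s ^ 2 / 2 + 5 * s ^ 4 / 96 := by linarith
    have hsin : Real.sin s ≤ s - s ^ 3 / 6 + 5 * s ^ 4 / 96 := by
      have : 0 ≤ s ^ 4 := by positivity
      linarith
    have hc1 := Real.cos_le_one s
    have m1 := mul_le_mul_of_nonneg_left hcos (by linarith : 0 ≤ 4.712 - s)
    have m2 : (Real.pi / 2 - s + Real.pi - (4.712 - s)) * Real.cos s ≤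
        Real.pi / 2 - s + Real.pi - (4.712 - s) :=
      mul_le_of_le_one_right (by linarith) hc1
    nlinarith [mul_nonneg (sub_nonneg.2 hu) (by linarith : 0 ≤ (Real.pi / 2 - s + Real.pi) + (4.712 - s) - 7)]
  -- For large `u` crude bounds suffice: `0.29995 u² - u - 2 ≥ 0` from `4.8` on.
  · have hs := Real.neg_one_le_sin u
    have hc := Real.neg_one_le_cos u
    nlinarith [mul_nonneg hu (by linarith : 0 ≤ Real.sin u + 1)]

/-! ### Evaluation of `ν̂` and its two-sided bounds. -/

/-- The density `c₂ |α|` on `[-Δ, Δ]`. -/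
def absDensity (Δ c₂ : ℝ) : ℝ → ℂ :=
  (Set.Icc (-Δ) Δ).indicator fun α => ((c₂ * |α| : ℝ) : ℂ)

theorem pwSymbol_absDensity (Δ c₂ : ℝ) : PWSymbol Δ (absDensity Δ c₂) := by
  refine PWSymbol.of_bounded (C := |c₂| * |Δ|) ?_ (fun t => ?_) fun t ht => ?_
  · exact (Continuous.aestronglyMeasurable (by fun_prop)).indicator measurableSet_Icc
  · by_cases ht : t ∈ Set.Icc (-Δ) Δ
    · rw [absDensity, Set.indicator_of_mem ht, Complex.norm_real, norm_mul, Real.norm_eq_abs,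
        Real.norm_eq_abs, abs_abs]
      exact mul_le_mul_of_nonneg_left ((abs_le.2 ht).trans (le_abs_self _)) (abs_nonneg _)
    · rw [absDensity, Set.indicator_of_notMem ht, norm_zero]
      exact mul_nonneg (abs_nonneg _) (abs_nonneg _)
  · rw [absDensity]
    refine Set.indicator_of_notMem (fun hc => ?_) _
    exact absurd (abs_le.2 hc) (not_le.2 ht)

theorem nuHat_nuMeasure {Δ c₁ c₂ : ℝ} (hc₁ : 0 ≤ c₁) (hc₂ : 0 ≤ c₂) (x : ℝ) :
    nuHat (nuMeasure Δ c₁ c₂) x = c₁ + 𝓕 (absDensity Δ c₂) x := by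
  have hm : Measurable fun α : ℝ => ENNReal.ofReal (c₂ * |α|) := by fun_prop
  have hm' : Measurable fun α : ℝ => Real.toNNReal (c₂ * |α|) := by fun_prop
  have e1 : ∫ α : ℝ, Complex.exp (-2 * Real.pi * Complex.I * x * α)
      ∂((volume.restrict (Set.Icc (-Δ) Δ)).withDensity fun α => ENNReal.ofReal (c₂ * |α|)) =
      𝓕 (absDensity Δ c₂) x := by
    have : (fun α : ℝ => ENNReal.ofReal (c₂ * |α|)) =
      fun α : ℝ => ((Real.toNNReal (c₂ * |α|) : NNReal) : ENNReal) := rfl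
    rw [this, integral_withDensity_eq_integral_smul hm', Real.fourier_real_eq_integral_exp_smul,
      ← integral_indicator measurableSet_Icc]
    refine integral_congr_ae (ae_of_all _ fun α => ?_)
    simp only [absDensity, Set.indicator_apply]
    split_ifs
    · rw [NNReal.smul_def, Real.coe_toNNReal _ (by positivity), Complex.real_smul, smul_eq_mul,
        mul_comm]
      congr 2
      push_cast
      ring
    · simp
  have hint : Integrable (fun α : ℝ => Complex.exp (-2 * Real.pi * Complex.I * x * α))
      ((volume.restrict (Set.Icc (-Δ) Δ)).withDensity fun α => ENNReal.ofReal (c₂ * |α|)) := by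
    have : IsFiniteMeasure ((volume.restrict (Set.Icc (-Δ) Δ)).withDensity
        fun α => ENNReal.ofReal (c₂ * |α|)) := by
      refine isFiniteMeasure_withDensity_ofReal ?_
      have : IntegrableOn (fun α : ℝ => c₂ * |α|) (Set.Icc (-Δ) Δ) :=
        ContinuousOn.integrableOn_compact isCompact_Icc (by fun_prop)
      exact this.2
    refine (integrable_const (1 : ℝ)).mono' (Continuous.aestronglyMeasurable (by fun_prop))
      (ae_of_all _ fun α => ?_)
    have : -2 * Real.pi * Complex.I * x * α = ((-2 * Real.pi * x * α : ℝ) : ℂ) * Complex.I := by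
      push_cast; ring
    rw [this, Complex.norm_exp_ofReal_mul_I]
  have hint0 : Integrable (fun α : ℝ => Complex.exp (-2 * Real.pi * Complex.I * x * α))
      (ENNReal.ofReal c₁ • Measure.dirac 0) :=
    (integrable_dirac (by simp)).smul_measure ENNReal.ofReal_ne_top
  rw [nuHat, nuMeasure, integral_add_measure hint0 hint, e1, integral_smul_measure, integral_dirac]
  simp [ENNReal.toReal_ofReal hc₁]

theorem integral_mul_cos_identity (κ Δ : ℝ) :
    κ ^ 2 * ∫ α in (0:ℝ)..Δ, α * Real.cos (κ * α) =
      κ * Δ * Real.sin (κ * Δ) + Real.cos (κ * Δ) - 1 := by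
  have hder : ∀ α : ℝ, HasDerivAt
      (fun α => κ * α * Real.sin (κ * α) + Real.cos (κ * α)) (κ ^ 2 * (α * Real.cos (κ * α))) α := by
    intro α
    have h := (hasDerivAt_id α).const_mul κ
    refine ((h.mul h.sin).add h.cos).congr_deriv ?_
    simp only [id, mul_one]
    ring
  rw [← intervalIntegral.integral_const_mul,
    intervalIntegral.integral_eq_sub_of_hasDerivAt (fun α _ => hder α)
      (Continuous.intervalIntegrable (by fun_prop) _ _)]
  simp

/-- With `u = κΔ`, the integral times `κ²` is `u sin u + cos u - 1`, so this is `trig_lower_bound`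
divided by `κ²`. -/
theorem integral_mul_cos_lower_bound (Δ κ : ℝ) :
    -(0.29995 * Δ ^ 2) ≤ ∫ α in (0:ℝ)..Δ, α * Real.cos (κ * α) := by
  rcases eq_or_ne κ 0 with rfl | hκ
  · simp
    nlinarith [sq_nonneg Δ]
  · have h := integral_mul_cos_identity κ Δ
    have hpos : 0 < κ ^ 2 := by positivity
    have key : 0 ≤ 0.29995 * (κ * Δ) ^ 2 + κ * Δ * Real.sin (κ * Δ) + Real.cos (κ * Δ) - 1 := by
      have := trig_lower_bound (abs_nonneg (κ * Δ))
      rw [sq_abs, Real.cos_abs] at this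
      rcases abs_choice (κ * Δ) with h' | h' <;> rw [h'] at this
      · exact this
      · rw [Real.sin_neg] at this
        linarith
    nlinarith

/-- The weight `ν̂` as a real function. -/
def weight (Δ c₁ c₂ x : ℝ) : ℝ :=
  c₁ + 2 * c₂ * ∫ α in (0:ℝ)..Δ, α * Real.cos (2 * Real.pi * x * α)

theorem fourier_absDensity {Δ : ℝ} (hΔ : 0 ≤ Δ) (c₂ x : ℝ) :
    𝓕 (absDensity Δ c₂) x =
      ((2 * c₂ * ∫ α in (0:ℝ)..Δ, α * Real.cos (2 * Real.pi * x * α) : ℝ) : ℂ) := by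
  let g : ℝ → ℂ := fun α => Complex.exp (-2 * Real.pi * Complex.I * x * α) * ((c₂ * |α| : ℝ) : ℂ)
  have hg : Continuous g := by fun_prop
  have hg' : IntervalIntegrable (fun α => g (-α)) volume 0 Δ :=
    (hg.comp continuous_neg).intervalIntegrable _ _
  have h1 : 𝓕 (absDensity Δ c₂) x = ∫ α in (-Δ)..Δ, g α := by
    rw [Real.fourier_real_eq_integral_exp_smul, intervalIntegral.integral_of_le (by linarith),
      ← integral_Icc_eq_integral_Ioc, ← integral_indicator measurableSet_Icc]
    refine integral_congr_ae (ae_of_all _ fun α => ?_)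
    simp only [absDensity, Set.indicator_apply, g]
    split_ifs
    · rw [smul_eq_mul]
      congr 2
      push_cast
      ring
    · simp
  have h2 : ∫ α in (-Δ)..0, g α = ∫ α in (0:ℝ)..Δ, g (-α) := by
    rw [intervalIntegral.integral_comp_neg, neg_zero]
  rw [h1, ← intervalIntegral.integral_add_adjacent_intervals (hg.intervalIntegrable _ 0)
    (hg.intervalIntegrable _ _), h2, ← intervalIntegral.integral_add
    hg' (hg.intervalIntegrable _ _),
    ← intervalIntegral.integral_const_mul, ← intervalIntegral.integral_ofReal]
  refine intervalIntegral.integral_congr fun α hα => ?_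
  rw [Set.uIcc_of_le hΔ] at hα
  simp only [g, abs_neg, abs_of_nonneg hα.1]
  push_cast
  rw [Complex.cos]
  have e1 : -2 * Real.pi * Complex.I * x * -α = 2 * Real.pi * x * α * Complex.I := by ring
  have e2 : -2 * Real.pi * Complex.I * x * α = -(2 * Real.pi * x * α) * Complex.I := by ring
  rw [e1, e2]
  ring

section weight

variable {Δ c₁ c₂ : ℝ}

theorem ofReal_weight (hΔ : 0 ≤ Δ) (x : ℝ) :
    ((weight Δ c₁ c₂ x : ℝ) : ℂ) = c₁ + 𝓕 (absDensity Δ c₂) x := by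
  rw [fourier_absDensity hΔ, weight]
  push_cast
  rfl

theorem nuHat_eq_weight (hΔ : 0 ≤ Δ) (hc₁ : 0 ≤ c₁) (hc₂ : 0 ≤ c₂) (x : ℝ) :
    nuHat (nuMeasure Δ c₁ c₂) x = ((weight Δ c₁ c₂ x : ℝ) : ℂ) := by
  rw [nuHat_nuMeasure hc₁ hc₂, ofReal_weight hΔ]

theorem continuous_weight (hΔ : 0 ≤ Δ) : Continuous (weight Δ c₁ c₂) := by
  have : weight Δ c₁ c₂ = fun x => ((c₁ : ℂ) + 𝓕 (absDensity Δ c₂) x).re := by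
    funext x
    rw [← ofReal_weight hΔ, Complex.ofReal_re]
  rw [this]
  exact Complex.continuous_re.comp
    (continuous_const.add (continuous_fourier_of_integrable (pwSymbol_absDensity Δ c₂).integrable))

theorem exists_weight_le (hΔ : 0 ≤ Δ) : ∃ C, ∀ x, |weight Δ c₁ c₂ x| ≤ C := by
  refine ⟨‖(c₁ : ℂ)‖ + ∫ t, ‖absDensity Δ c₂ t‖, fun x => ?_⟩
  rw [← Real.norm_eq_abs, ← Complex.norm_real, ofReal_weight hΔ]
  exact (norm_add_le _ _).trans (add_le_add_right (norm_fourier_le_integral_norm _ x) _)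

/-- The constant `0.29995` is chosen just below `0.3`: then `2 · (5/3) · 0.29995 < 0.9999`, so the
negative part of `ν̂` cannot use up `c₁`. -/
theorem exists_le_weight (hc₁ : 0 < c₁) (hc₂ : 0 ≤ c₂)
    (h : c₂ / c₁ * Δ ^ 2 ≤ 5 / 3) : ∃ δ, 0 < δ ∧ ∀ x, δ ≤ weight Δ c₁ c₂ x := by
  refine ⟨c₁ * 0.0001, by positivity, fun x => ?_⟩
  have h1 := integral_mul_cos_lower_bound Δ (2 * Real.pi * x)
  have h2 : c₂ * Δ ^ 2 ≤ 5 / 3 * c₁ := by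
    rwa [div_mul_eq_mul_div, div_le_iff₀ hc₁] at h
  rw [weight]
  nlinarith

end weight

/-! ### The space `𝓗_ν` -/

/-- As `ν̂` is bounded above and away from zero, weighted and unweighted square integrability agree,
and the Paley–Wiener theorem applies with `2πb = πΔ`. -/
theorem mem_weightedPW_iff {Δ c₁ c₂ : ℝ} (hΔ : 0 < Δ) (hc₁ : 0 < c₁) (hc₂ : 0 ≤ c₂)
    (h : c₂ / c₁ * Δ ^ 2 ≤ 5 / 3) (f : ℂ → ℂ) :
    f ∈ weightedPW Δ (nuMeasure Δ c₁ c₂) ↔ ∃ φ, PWSymbol (Δ / 2) φ ∧ f = pwTransform φ := by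
  have hτ : Real.pi * Δ = 2 * Real.pi * (Δ / 2) := by ring
  have hν : ∀ x : ℝ, ((‖f x‖ ^ 2 : ℝ) : ℂ) * nuHat (nuMeasure Δ c₁ c₂) x =
      ((‖f x‖ ^ 2 * weight Δ c₁ c₂ x : ℝ) : ℂ) := fun x => by
    rw [nuHat_eq_weight hΔ.le hc₁.le hc₂]
    push_cast
    rfl
  obtain ⟨δ, hδ, hδw⟩ := exists_le_weight hc₁ hc₂ h
  obtain ⟨C, hC⟩ := exists_weight_le (Δ := Δ) (c₁ := c₁) (c₂ := c₂) hΔ.le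
  rw [weightedPW, Set.mem_ofPred_eq, hτ]
  simp only [hν]
  constructor
  · rintro ⟨hd, ht, hi⟩
    refine exists_pwTransform_eq hd ht ?_
    have hfm : AEStronglyMeasurable (fun x : ℝ => f x) volume :=
      (hd.continuous.comp Complex.continuous_ofReal).aestronglyMeasurable
    rw [memLp_two_iff_integrable_sq_norm hfm]
    have hi' : Integrable fun x : ℝ => ‖f x‖ ^ 2 * weight Δ c₁ c₂ x := by
      exact hi.re.congr (ae_of_all _ fun x => Complex.ofReal_re _)
    refine (hi'.const_mul δ⁻¹).mono' (hfm.norm.pow 2) (ae_of_all _ fun x => ?_)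
    rw [Real.norm_of_nonneg (by positivity), inv_mul_eq_div, le_div_iff₀ hδ]
    exact mul_le_mul_of_nonneg_left (hδw x) (by positivity)
  · rintro ⟨φ, hφ, rfl⟩
    refine ⟨hφ.differentiable, hφ.expTypeLE, ?_⟩
    have h2 := hφ.memLp_pwTransform
    have hsq := (memLp_two_iff_integrable_sq_norm h2.aestronglyMeasurable).1 h2
    refine Integrable.ofReal ?_
    refine hsq.mul_bdd (c := C) (continuous_weight hΔ.le).aestronglyMeasurable
      (ae_of_all _ fun x => hC x)

/-! ### Band-limited functions, evaluation functionals and the model of `𝓗_ν`. -/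

/-- The square integrable functions supported in `[-b, b]`. -/
def bandSpace (b : ℝ) : Submodule ℂ (Lp ℂ 2 (volume : Measure ℝ)) :=
  LinearMap.ker (LpToLpRestrictCLM ℝ ℂ ℂ volume 2 {t : ℝ | b < |t|}).toLinearMap

theorem mem_bandSpace_iff {b : ℝ} {φ : Lp ℂ 2 (volume : Measure ℝ)} :
    φ ∈ bandSpace b ↔ ∀ᵐ t : ℝ, b < |t| → φ t = 0 := by
  have hm : MeasurableSet {t : ℝ | b < |t|} := measurableSet_lt measurable_const (by fun_prop)
  rw [bandSpace, LinearMap.mem_ker, ContinuousLinearMap.coe_coe, Lp.eq_zero_iff_ae_eq_zero]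
  have h1 := LpToLpRestrictCLM_coeFn (p := 2) ℂ {t : ℝ | b < |t|} φ
  rw [show (∀ᵐ t : ℝ, b < |t| → φ t = 0) ↔ ∀ᵐ t ∂volume.restrict {t : ℝ | b < |t|}, φ t = 0 from
    (ae_restrict_iff' hm).symm]
  constructor
  · intro h
    filter_upwards [h, h1] with t h2 h3
    rw [← h3, h2, Pi.zero_apply]
  · intro h
    filter_upwards [h, h1] with t h2 h3
    rw [h3, h2, Pi.zero_apply]

instance (b : ℝ) : CompleteSpace (bandSpace b) :=
  (LpToLpRestrictCLM ℝ ℂ ℂ volume 2 {t : ℝ | b < |t|}).isClosed_ker.completeSpace_coe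

theorem exists_pwSymbol_toLp_eq {b : ℝ} (φ : bandSpace b) :
    ∃ ψ, ∃ h : PWSymbol b ψ, h.memLp.toLp ψ = φ := by
  have hφF : (Set.Icc (-b) b).indicator (φ : Lp ℂ 2 (volume : Measure ℝ)) =ᵐ[volume]
      (φ : Lp ℂ 2 (volume : Measure ℝ)) := by
    filter_upwards [mem_bandSpace_iff.1 φ.2] with t h
    by_cases htm : t ∈ Set.Icc (-b) b
    · rw [Set.indicator_of_mem htm]
    · rw [Set.indicator_of_notMem htm, h]
      by_contra hc
      exact htm (abs_le.1 (not_lt.1 hc))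
  have hs : PWSymbol b ((Set.Icc (-b) b).indicator (φ : Lp ℂ 2 (volume : Measure ℝ))) := by
    refine ⟨(Lp.memLp _).ae_eq hφF.symm, fun t ht => Set.indicator_of_notMem (fun hc => ?_) _⟩
    exact absurd (abs_le.2 hc) (not_le.2 ht)
  exact ⟨_, hs, Lp.ext (hs.memLp.coeFn_toLp.trans hφF)⟩

theorem PWSymbol.toLp_mem {b : ℝ} {φ : ℝ → ℂ} (h : PWSymbol b φ) :
    h.memLp.toLp φ ∈ bandSpace b := by
  rw [mem_bandSpace_iff]
  filter_upwards [h.memLp.coeFn_toLp] with t ht hb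
  rw [ht, h.eq_zero t hb]

/-- The exponential `t ↦ e^{2πi w̄ t}` cut off to `[-b, b]`. -/
def cutExp (b : ℝ) (w : ℂ) : ℝ → ℂ :=
  (Set.Icc (-b) b).indicator fun t => Complex.exp (2 * Real.pi * Complex.I * t * conj w)

theorem pwSymbol_cutExp (b : ℝ) (w : ℂ) : PWSymbol b (cutExp b w) := by
  refine PWSymbol.of_bounded (C := Real.exp (2 * Real.pi * |b| * ‖w‖)) ?_ (fun t => ?_)
    fun t ht => ?_
  · exact (Continuous.aestronglyMeasurable (by fun_prop)).indicator measurableSet_Icc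
  · by_cases ht : t ∈ Set.Icc (-b) b
    · rw [cutExp, Set.indicator_of_mem ht]
      refine (Complex.norm_exp_le_exp_norm _).trans (Real.exp_le_exp.2 ?_)
      simp only [norm_mul, Complex.norm_ofNat, Complex.norm_real, Complex.norm_I,
        Real.norm_eq_abs, abs_of_pos Real.pi_pos, mul_one, RCLike.norm_conj]
      have := (abs_le.2 ht).trans (le_abs_self b)
      gcongr
    · rw [cutExp, Set.indicator_of_notMem ht, norm_zero]
      positivity
  · rw [cutExp]
    refine Set.indicator_of_notMem (fun hc => ?_) _
    exact absurd (abs_le.2 hc) (not_le.2 ht)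

/-- Evaluation of the transform is the inner product with a cut-off exponential. -/
theorem PWSymbol.integral_conj_cutExp_mul {b : ℝ} {φ : ℝ → ℂ} (h : PWSymbol b φ) (w : ℂ) :
    ∫ t, conj (cutExp b w t) * φ t = pwTransform φ w := by
  rw [pwTransform]
  refine integral_congr_ae (ae_of_all _ fun t => ?_)
  simp only
  by_cases ht : t ∈ Set.Icc (-b) b
  · rw [cutExp, Set.indicator_of_mem ht, ← Complex.exp_conj, mul_comm]
    congr 2
    simp only [map_mul, Complex.conj_ofReal, Complex.conj_I, map_ofNat, Complex.conj_conj]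
    ring
  · have : φ t = 0 := h.eq_zero t (by
      by_contra hc
      exact ht (abs_le.1 (not_lt.1 hc)))
    rw [this, mul_zero, zero_mul]

/-- The cut-off exponential as an element of `L²`. -/
def cutExpLp (b : ℝ) (w : ℂ) : Lp ℂ 2 (volume : Measure ℝ) :=
  (pwSymbol_cutExp b w).memLp.toLp _

theorem PWSymbol.inner_cutExpLp {b : ℝ} {φ : ℝ → ℂ} (h : PWSymbol b φ) (w : ℂ) :
    inner ℂ (cutExpLp b w) (h.memLp.toLp φ) = pwTransform φ w := by
  rw [← h.integral_conj_cutExp_mul w]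
  exact inner_Lp_eq_integral (pwSymbol_cutExp b w).memLp.coeFn_toLp h.memLp.coeFn_toLp

theorem memLp_ofReal_mul {m : ℝ → ℝ} (hm : Continuous m) {C : ℝ} (hC : ∀ x, |m x| ≤ C)
    (f : Lp ℂ 2 (volume : Measure ℝ)) : MemLp (fun x => (m x : ℂ) * f x) 2 :=
  (Lp.memLp f).of_le_mul (c := C)
    ((Complex.continuous_ofReal.comp hm).aestronglyMeasurable.mul (Lp.aestronglyMeasurable f))
    (ae_of_all _ fun x => by
      rw [norm_mul, Complex.norm_real]
      exact mul_le_mul_of_nonneg_right (hC x) (norm_nonneg _))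

/-- Multiplication by a bounded continuous function on `L²`. -/
def mulLp (m : ℝ → ℝ) (hm : Continuous m) (C : ℝ) (hC : ∀ x, |m x| ≤ C) :
    Lp ℂ 2 (volume : Measure ℝ) →L[ℂ] Lp ℂ 2 (volume : Measure ℝ) :=
  LinearMap.mkContinuous
    { toFun := fun f => (memLp_ofReal_mul hm hC f).toLp _
      map_add' := fun f g => by
        rw [← MemLp.toLp_add, MemLp.toLp_eq_toLp_iff]
        filter_upwards [Lp.coeFn_add f g] with x hx
        rw [hx, Pi.add_apply, Pi.add_apply, mul_add]
      map_smul' := fun c f => by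
        rw [RingHom.id_apply, ← MemLp.toLp_const_smul, MemLp.toLp_eq_toLp_iff]
        filter_upwards [Lp.coeFn_smul c f] with x hx
        rw [hx, Pi.smul_apply, Pi.smul_apply, smul_eq_mul, smul_eq_mul, mul_left_comm] }
    C fun f => by
      refine Lp.norm_le_mul_norm_of_ae_le_mul ?_
      filter_upwards [(memLp_ofReal_mul hm hC f).coeFn_toLp] with x hx
      change ‖(memLp_ofReal_mul hm hC f).toLp _ x‖ ≤ _
      rw [hx, norm_mul, Complex.norm_real]
      exact mul_le_mul_of_nonneg_right (hC x) (norm_nonneg _)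

theorem mulLp_ae_eq (m : ℝ → ℝ) (hm : Continuous m) (C : ℝ) (hC : ∀ x, |m x| ≤ C)
    (f : Lp ℂ 2 (volume : Measure ℝ)) :
    mulLp m hm C hC f =ᵐ[volume] fun x => (m x : ℂ) * f x :=
  (memLp_ofReal_mul hm hC f).coeFn_toLp

/-- The space `𝓗_ν` is a reproducing kernel Hilbert space. -/
theorem exists_isWeightedPW {Δ c₁ c₂ : ℝ} (hΔ : 0 < Δ) (hc₁ : 0 < c₁) (hc₂ : 0 ≤ c₂)
    (h : c₂ / c₁ * Δ ^ 2 ≤ 5 / 3) :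
    ∃ (H : Type) (_ : NormedAddCommGroup H) (_ : InnerProductSpace ℂ H) (_ : CompleteSpace H)
      (_ : RKHS ℂ H ℂ ℂ), IsWeightedPW Δ (nuMeasure Δ c₁ c₂) H := by
  obtain ⟨δ, hδ, hδw⟩ := exists_le_weight hc₁ hc₂ h
  obtain ⟨C, hC⟩ := exists_weight_le (Δ := Δ) (c₁ := c₁) (c₂ := c₂) hΔ.le
  have hw0 : ∀ x, 0 ≤ weight Δ c₁ c₂ x := fun x => hδ.le.trans (hδw x)
  -- Multiplying transforms by `√ν̂` turns the weighted inner product into the ordinary one of `L²`.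
  let m : ℝ → ℝ := fun x => √(weight Δ c₁ c₂ x)
  have hm : Continuous m := (continuous_weight hΔ.le).sqrt
  have hmC : ∀ x, |m x| ≤ √C := fun x => by
    rw [abs_of_nonneg (Real.sqrt_nonneg _)]
    exact Real.sqrt_le_sqrt ((le_abs_self _).trans (hC x))
  let F : Lp ℂ 2 (volume : Measure ℝ) →L[ℂ] Lp ℂ 2 (volume : Measure ℝ) :=
    ((Lp.fourierTransformₗᵢ ℝ ℂ).toContinuousLinearEquiv :
      Lp ℂ 2 (volume : Measure ℝ) →L[ℂ] Lp ℂ 2 (volume : Measure ℝ))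
  have hF : ∀ φ, F φ = 𝓕 φ := fun φ => rfl
  let A : bandSpace (Δ / 2) →L[ℂ] Lp ℂ 2 (volume : Measure ℝ) :=
    (mulLp m hm _ hmC).comp (F.comp (bandSpace (Δ / 2)).subtypeL)
  have hA : ∀ φ : bandSpace (Δ / 2), A φ = mulLp m hm _ hmC (𝓕 (φ : Lp ℂ 2 (volume : Measure ℝ))) :=
    fun φ => rfl
  -- The lower bound on `ν̂` makes `A` bounded below, hence injective with closed range.
  have hAbound : ∀ φ : bandSpace (Δ / 2), ‖φ‖ ≤ (Real.toNNReal (√δ)⁻¹ : NNReal) * ‖A φ‖ := by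
    intro φ
    have : ‖φ‖ = ‖𝓕 (φ : Lp ℂ 2 (volume : Measure ℝ))‖ := by
      rw [Lp.norm_fourier_eq, Submodule.coe_norm]
    rw [this, hA, Real.coe_toNNReal _ (by positivity)]
    refine Lp.norm_le_mul_norm_of_ae_le_mul ?_
    filter_upwards [mulLp_ae_eq m hm _ hmC (𝓕 (φ : Lp ℂ 2 (volume : Measure ℝ)))] with x hx
    rw [hx, norm_mul, Complex.norm_real, ← mul_assoc, Real.norm_of_nonneg (Real.sqrt_nonneg _)]
    refine le_mul_of_one_le_left (norm_nonneg _) ?_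
    rw [inv_mul_eq_div, one_le_div (Real.sqrt_pos.2 hδ)]
    exact Real.sqrt_le_sqrt (hδw x)
  have hanti := A.antilipschitz_of_bound hAbound
  have hclosed : IsClosed (Set.range A) := hanti.isClosed_range A.uniformContinuous
  let e := A.equivRange hanti.injective hclosed
  have he : ∀ φ, ((e φ : (A : bandSpace (Δ / 2) →ₗ[ℂ] Lp ℂ 2 (volume : Measure ℝ)).range) :
      Lp ℂ 2 (volume : Measure ℝ)) = A φ := fun φ => rfl
  -- As a closed subspace of `L²`, the range inherits completeness and the right inner product. A
  -- vector is read as an entire function by pairing its preimage with the cut-off exponentials.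
  let H : Type := (A : bandSpace (Δ / 2) →ₗ[ℂ] Lp ℂ 2 (volume : Measure ℝ)).range
  let ev : H →L[ℂ] (ℂ → ℂ) := ContinuousLinearMap.pi fun z =>
    (innerSL ℂ (cutExpLp (Δ / 2) z)).comp ((bandSpace (Δ / 2)).subtypeL.comp
      (e.symm : H →L[ℂ] bandSpace (Δ / 2)))
  have hev : ∀ (f : H) (ψ : ℝ → ℂ) (hψ : PWSymbol (Δ / 2) ψ),
      hψ.memLp.toLp ψ = ((e.symm f : bandSpace (Δ / 2)) : Lp ℂ 2 (volume : Measure ℝ)) →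
      ev f = pwTransform ψ := by
    intro f ψ hψ hf
    funext z
    rw [← hψ.inner_cutExpLp z, hf]
    rfl
  have hinj : Function.Injective ev := by
    rw [injective_iff_map_eq_zero]
    intro f hf
    obtain ⟨ψ, hψ, hψf⟩ := exists_pwSymbol_toLp_eq (e.symm f)
    have h0 := hev f ψ hψ hψf
    rw [hf] at h0
    have h1 := ae_eq_zero_of_fourier_eq_zero hψ.integrable hψ.memLp fun x => by
      rw [← pwTransform_ofReal, ← h0, Pi.zero_apply]
    have h2 : e.symm f = 0 := by
      rw [← Submodule.coe_eq_zero, ← hψf, Lp.eq_zero_iff_ae_eq_zero]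
      exact hψ.memLp.coeFn_toLp.trans h1
    simpa using h2
  have hcomplete : CompleteSpace H := by
    have : IsClosed ((A : bandSpace (Δ / 2) →ₗ[ℂ] Lp ℂ 2 (volume : Measure ℝ)).range :
        Set (Lp ℂ 2 (volume : Measure ℝ))) := by
      rw [LinearMap.coe_range]
      exact hclosed
    exact this.completeSpace_coe
  let R : RKHS ℂ H ℂ ℂ := { coeCLM := ev, coeCLM_injective := hinj }
  refine ⟨H, inferInstance, inferInstance, hcomplete, R, ?_, ?_⟩
  · ext f
    rw [mem_weightedPW_iff hΔ hc₁ hc₂ h]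
    constructor
    · rintro ⟨g, rfl⟩
      obtain ⟨ψ, hψ, hψf⟩ := exists_pwSymbol_toLp_eq (e.symm g)
      exact ⟨ψ, hψ, hev g ψ hψ hψf⟩
    · rintro ⟨ψ, hψ, rfl⟩
      refine ⟨e ⟨_, hψ.toLp_mem⟩, hev _ ψ hψ ?_⟩
      rw [ContinuousLinearEquiv.symm_apply_apply]
  · intro f g
    obtain ⟨ψ, hψ, hψf⟩ := exists_pwSymbol_toLp_eq (e.symm f)
    obtain ⟨χ, hχ, hχg⟩ := exists_pwSymbol_toLp_eq (e.symm g)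
    have hcoe : ∀ (f : H) (ψ : ℝ → ℂ) (hψ : PWSymbol (Δ / 2) ψ),
        hψ.memLp.toLp ψ = ((e.symm f : bandSpace (Δ / 2)) : Lp ℂ 2 (volume : Measure ℝ)) →
        ((f : Lp ℂ 2 (volume : Measure ℝ)) : ℝ → ℂ) =ᵐ[volume]
          fun x : ℝ => (m x : ℂ) * pwTransform ψ x := by
      intro f ψ hψ hf
      have h1 : (f : Lp ℂ 2 (volume : Measure ℝ)) = A (e.symm f) := by
        rw [← he, ContinuousLinearEquiv.apply_symm_apply]
      rw [h1, hA, ← hf]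
      filter_upwards [mulLp_ae_eq m hm _ hmC (𝓕 (hψ.memLp.toLp ψ)),
        hψ.fourier_toLp_ae_eq_pwTransform] with x h2 h3
      rw [h2, h3]
    have hf := hev f ψ hψ hψf
    have hg := hev g χ hχ hχg
    change inner ℂ (f : Lp ℂ 2 (volume : Measure ℝ)) (g : Lp ℂ 2 (volume : Measure ℝ)) =
      ∫ x : ℝ, conj (ev f x) * ev g x * _
    rw [inner_Lp_eq_integral (hcoe f ψ hψ hψf) (hcoe g χ hχ hχg), hf, hg]
    refine integral_congr_ae (ae_of_all _ fun x => ?_)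
    simp only
    rw [nuHat_eq_weight hΔ.le hc₁.le hc₂, map_mul, Complex.conj_ofReal]
    have : (weight Δ c₁ c₂ x : ℂ) = (m x : ℂ) * (m x : ℂ) := by
      rw [← Complex.ofReal_mul, Real.mul_self_sqrt (hw0 x)]
    rw [this]
    ring

/-! ### The integral equation for the kernel -/

/-- Split at `s = t` and use the antiderivative `(l(t - s) + 1) e^{ls}` of `l²(t - s) e^{ls}`. The
factor `l²` avoids a division, so `l = 0` needs no separate treatment. -/
theorem sq_mul_integral_abs_sub_mul_exp (l : ℂ) {h t : ℝ} (h1 : -h ≤ t) (h2 : t ≤ h) :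
    l ^ 2 * ∫ s in (-h)..h, ((|t - s| : ℝ) : ℂ) * Complex.exp (l * s) =
      2 * Complex.exp (l * t) - (l * (t + h) + 1) * Complex.exp (-(l * h)) -
        (l * (t - h) + 1) * Complex.exp (l * h) := by
  have hc : Continuous fun s : ℝ => ((|t - s| : ℝ) : ℂ) * Complex.exp (l * s) := by fun_prop
  let g : ℝ → ℂ := fun s => (l * (t - s) + 1) * Complex.exp (l * s)
  have hder : ∀ s : ℝ, HasDerivAt g (l ^ 2 * ((t - s) * Complex.exp (l * s))) s := by
    intro s
    have d1 : HasDerivAt (fun s : ℝ => (s : ℂ)) 1 s := Complex.ofRealCLM.hasDerivAt (x := s)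
    refine ((((d1.const_sub (t : ℂ)).const_mul l).add_const 1).mul (d1.const_mul l).cexp).congr_deriv ?_
    ring
  have i1 : l ^ 2 * ∫ s in (-h)..t, ((|t - s| : ℝ) : ℂ) * Complex.exp (l * s) = g t - g (-h) := by
    rw [← intervalIntegral.integral_eq_sub_of_hasDerivAt (fun s _ => hder s)
      (Continuous.intervalIntegrable (by fun_prop) _ _), ← intervalIntegral.integral_const_mul]
    refine intervalIntegral.integral_congr fun s hs => ?_
    rw [Set.uIcc_of_le h1] at hs
    simp only [abs_of_nonneg (sub_nonneg.2 hs.2), Complex.ofReal_sub]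
  have i2 : l ^ 2 * ∫ s in t..h, ((|t - s| : ℝ) : ℂ) * Complex.exp (l * s) = -(g h - g t) := by
    rw [← intervalIntegral.integral_eq_sub_of_hasDerivAt (fun s _ => hder s)
      (Continuous.intervalIntegrable (by fun_prop) _ _), ← intervalIntegral.integral_const_mul,
      ← intervalIntegral.integral_neg]
    refine intervalIntegral.integral_congr fun s hs => ?_
    rw [Set.uIcc_of_le h2] at hs
    simp only [abs_of_nonpos (sub_nonpos.2 hs.1), Complex.ofReal_sub, Complex.ofReal_neg]
    ring
  rw [← intervalIntegral.integral_add_adjacent_intervals (hc.intervalIntegrable _ t)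
    (hc.intervalIntegrable _ _), mul_add, i1, i2]
  simp only [g, Complex.ofReal_neg, mul_neg]
  ring

theorem mul_integral_exp (l : ℂ) (h : ℝ) :
    l * ∫ s in (-h)..h, Complex.exp (l * s) = Complex.exp (l * h) - Complex.exp (-(l * h)) := by
  have hder : ∀ s : ℝ, HasDerivAt (fun s : ℝ => Complex.exp (l * s)) (l * Complex.exp (l * s)) s := by
    intro s
    have d1 : HasDerivAt (fun s : ℝ => (s : ℂ)) 1 s := Complex.ofRealCLM.hasDerivAt (x := s)
    refine (d1.const_mul l).cexp.congr_deriv ?_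
    ring
  rw [← intervalIntegral.integral_const_mul,
    intervalIntegral.integral_eq_sub_of_hasDerivAt (fun s _ => hder s)
      (Continuous.intervalIntegrable (by fun_prop) _ _)]
  simp

/-! ### The constants of the formula and their nonvanishing denominators. -/

/-- The frequency `√(2 c₂ / c₁)` of the homogeneous solutions of the integral equation. -/
def freq (c₁ c₂ : ℝ) : ℝ := √(2 * c₂ / c₁)

section freq

variable {Δ c₁ c₂ : ℝ}

theorem freq_sq (hc₁ : 0 < c₁) (hc₂ : 0 ≤ c₂) : c₁ * freq c₁ c₂ ^ 2 = 2 * c₂ := by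
  rw [freq, Real.sq_sqrt (by positivity)]
  field_simp

theorem sqrt_two_mul_mul (hc₁ : 0 < c₁) : √(2 * c₁ * c₂) = c₁ * freq c₁ c₂ := by
  have : 2 * c₁ * c₂ = c₁ ^ 2 * (2 * c₂ / c₁) := by field_simp
  rw [this, Real.sqrt_mul (by positivity), Real.sqrt_sq hc₁.le, freq]

theorem freq_eq : freq c₁ c₂ = 2 * √(c₂ / (2 * c₁)) := by
  have : 2 * c₂ / c₁ = 2 ^ 2 * (c₂ / (2 * c₁)) := by
    rcases eq_or_ne c₁ 0 with rfl | h
    · simp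
    · field_simp
  rw [freq, this, Real.sqrt_mul (by positivity), Real.sqrt_sq (by norm_num)]

theorem freq_mul_half : freq c₁ c₂ * (Δ / 2) = theta Δ c₁ c₂ := by
  rw [freq_eq, theta]
  ring

theorem theta_nonneg (hΔ : 0 ≤ Δ) : 0 ≤ theta Δ c₁ c₂ := mul_nonneg (Real.sqrt_nonneg _) hΔ

/-- The hypothesis gives `θ² ≤ 5/6`. Thus `θ` stays below `π/2`, and the `θ`-dependent denominators
of `coefA` and `coefB` are positive. -/
theorem theta_le_one (hΔ : 0 < Δ) (hc₁ : 0 < c₁) (hc₂ : 0 ≤ c₂)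
    (h : c₂ / c₁ * Δ ^ 2 ≤ 5 / 3) : theta Δ c₁ c₂ ≤ 1 := by
  have h1 : theta Δ c₁ c₂ ^ 2 = c₂ / c₁ * Δ ^ 2 / 2 := by
    rw [theta, mul_pow, Real.sq_sqrt (by positivity)]
    field_simp
  nlinarith [theta_nonneg (c₁ := c₁) (c₂ := c₂) hΔ.le]

theorem cos_theta_pos (hΔ : 0 < Δ) (hc₁ : 0 < c₁) (hc₂ : 0 ≤ c₂)
    (h : c₂ / c₁ * Δ ^ 2 ≤ 5 / 3) : 0 < Real.cos (theta Δ c₁ c₂) := by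
  have h0 := theta_nonneg (c₁ := c₁) (c₂ := c₂) hΔ.le
  have h1 := theta_le_one hΔ hc₁ hc₂ h
  exact Real.cos_pos_of_mem_Ioo ⟨by linarith [Real.pi_pos], by linarith [Real.pi_gt_three]⟩

theorem coefA_denominator_pos (hΔ : 0 < Δ) (hc₁ : 0 < c₁) (hc₂ : 0 ≤ c₂)
    (h : c₂ / c₁ * Δ ^ 2 ≤ 5 / 3) :
    0 < 2 * Real.cos (theta Δ c₁ c₂) + √(2 * c₂ / c₁) * Δ * Real.sin (theta Δ c₁ c₂) := by
  have h0 := theta_nonneg (c₁ := c₁) (c₂ := c₂) hΔ.le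
  have h1 := theta_le_one hΔ hc₁ hc₂ h
  have h2 := cos_theta_pos hΔ hc₁ hc₂ h
  have h3 : 0 ≤ Real.sin (theta Δ c₁ c₂) :=
    Real.sin_nonneg_of_nonneg_of_le_pi h0 (by linarith [Real.pi_gt_three])
  positivity

theorem denominator_ne_zero (hc₁ : 0 < c₁) (hc₂ : 0 ≤ c₂) {v : ℂ}
    (hv : v ∉ exceptionalPoints c₁ c₂) : 2 * c₁ * Real.pi ^ 2 * v ^ 2 - (c₂ : ℂ) ≠ 0 := by
  intro h0
  set p : ℝ := 1 / Real.pi * √(c₂ / (2 * c₁)) with hp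
  have h1 : 2 * c₁ * Real.pi ^ 2 * p ^ 2 = c₂ := by
    rw [hp, mul_pow, Real.sq_sqrt (by positivity)]
    field_simp
  have h2 : 2 * (c₁ : ℂ) * Real.pi ^ 2 * (p : ℂ) ^ 2 = c₂ := by exact_mod_cast h1
  have h3 : (2 * (c₁ : ℂ) * Real.pi ^ 2) * ((v - p) * (v + p)) = 0 := by
    linear_combination h0 - h2
  have h4 : (2 * (c₁ : ℂ) * Real.pi ^ 2) ≠ 0 := by
    have : (c₁ : ℂ) ≠ 0 := by exact_mod_cast hc₁.ne'
    have : (Real.pi : ℂ) ≠ 0 := by exact_mod_cast Real.pi_ne_zero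
    simp_all
  rcases mul_eq_zero.1 ((mul_eq_zero.1 h3).resolve_left h4) with h5 | h5
  · exact hv (Or.inl (sub_eq_zero.1 h5))
  · exact hv (Or.inr (eq_neg_of_add_eq_zero_left h5))

theorem conj_mem_exceptionalPoints {w : ℂ} :
    conj w ∈ exceptionalPoints c₁ c₂ ↔ w ∈ exceptionalPoints c₁ c₂ := by
  have : ∀ u : ℂ, u ∈ exceptionalPoints c₁ c₂ → conj u ∈ exceptionalPoints c₁ c₂ := by
    rintro u (rfl | rfl)
    · exact Or.inl (Complex.conj_ofReal _)
    · refine Or.inr ?_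
      rw [map_neg, Complex.conj_ofReal]
      rfl
  refine ⟨fun h => ?_, this w⟩
  have := this _ h
  rwa [Complex.conj_conj] at this

end freq

/-- The solution of the integral equation, as a function of `v = w̄`. -/
def kernelSymbolFun (Δ c₁ c₂ : ℝ) (v : ℂ) (t : ℝ) : ℂ :=
  coefA Δ c₁ c₂ v * Complex.cos (freq c₁ c₂ * t) - coefB Δ c₁ c₂ v * Complex.sin (freq c₁ c₂ * t) +
    coefC c₁ c₂ v * Complex.exp (2 * Real.pi * Complex.I * v * t)

theorem continuous_kernelSymbolFun (Δ c₁ c₂ : ℝ) (v : ℂ) :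
    Continuous (kernelSymbolFun Δ c₁ c₂ v) := by
  unfold kernelSymbolFun
  fun_prop

/-- The operator `c₁ + c₂|·|*` on the interval sends `cos ωt` to a constant, `sin ωt` to a multiple
of `t`, and the exponential to a multiple of itself plus such terms. The three coefficients are
exactly those that leave `e^{2πivt}` alone. -/
theorem kernelSymbolFun_integral_equation {Δ c₁ c₂ : ℝ} (hΔ : 0 < Δ) (hc₁ : 0 < c₁) (hc₂ : 0 ≤ c₂)
    (h : c₂ / c₁ * Δ ^ 2 ≤ 5 / 3) {v : ℂ} (hv : v ∉ exceptionalPoints c₁ c₂) {t : ℝ}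
    (h1 : -(Δ / 2) ≤ t) (h2 : t ≤ Δ / 2) :
    c₁ * kernelSymbolFun Δ c₁ c₂ v t +
      c₂ * ∫ s in (-(Δ / 2))..(Δ / 2), ((|t - s| : ℝ) : ℂ) * kernelSymbolFun Δ c₁ c₂ v s =
    Complex.exp (2 * Real.pi * Complex.I * v * t) := by
  have hD := denominator_ne_zero hc₁ hc₂ hv
  have hden : ((2 * Real.cos (theta Δ c₁ c₂) +
      √(2 * c₂ / c₁) * Δ * Real.sin (theta Δ c₁ c₂) : ℝ) : ℂ) ≠ 0 := by
    exact_mod_cast (coefA_denominator_pos hΔ hc₁ hc₂ h).ne'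
  have hcos : ((Real.cos (theta Δ c₁ c₂) : ℝ) : ℂ) ≠ 0 := by
    exact_mod_cast (cos_theta_pos hΔ hc₁ hc₂ h).ne'
  have hc₁' : (c₁ : ℂ) ≠ 0 := by exact_mod_cast hc₁.ne'
  set ω : ℝ := freq c₁ c₂ with hω
  have hωsq : (c₁ : ℂ) * (ω : ℂ) ^ 2 = 2 * c₂ := by exact_mod_cast freq_sq hc₁ hc₂
  have hth : theta Δ c₁ c₂ = ω * (Δ / 2) := freq_mul_half.symm
  set J : ℂ → ℂ := fun l => ∫ s in (-(Δ / 2))..(Δ / 2), ((|t - s| : ℝ) : ℂ) * Complex.exp (l * s)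
    with hJ
  have hJl := fun l => sq_mul_integral_abs_sub_mul_exp l h1 h2
  have hint : ∀ l : ℂ, IntervalIntegrable
      (fun s : ℝ => ((|t - s| : ℝ) : ℂ) * Complex.exp (l * s)) volume (-(Δ / 2)) (Δ / 2) := fun l =>
    Continuous.intervalIntegrable (by fun_prop) _ _
  set A := coefA Δ c₁ c₂ v with hA
  set B := coefB Δ c₁ c₂ v with hB
  set C := coefC c₁ c₂ v with hC
  have hsplit : ∫ s in (-(Δ / 2))..(Δ / 2), ((|t - s| : ℝ) : ℂ) * kernelSymbolFun Δ c₁ c₂ v s =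
      (A / 2 + B * Complex.I / 2) * J (Complex.I * ω) +
        (A / 2 - B * Complex.I / 2) * J (-(Complex.I * ω)) + C * J (2 * Real.pi * Complex.I * v) := by
    simp only [hJ]
    rw [← intervalIntegral.integral_const_mul, ← intervalIntegral.integral_const_mul,
      ← intervalIntegral.integral_const_mul, ← intervalIntegral.integral_add
        ((hint _).const_mul _) ((hint _).const_mul _), ← intervalIntegral.integral_add
        (((hint _).const_mul _).add ((hint _).const_mul _)) ((hint _).const_mul _)]
    refine intervalIntegral.integral_congr fun s _ => ?_
    simp only [kernelSymbolFun, Complex.cos, Complex.sin, ← hA, ← hB, ← hC, ← hω]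
    have e1 : (ω : ℂ) * s * Complex.I = Complex.I * ω * s := by ring
    have e2 : -((ω : ℂ) * s) * Complex.I = -(Complex.I * ω) * s := by ring
    rw [e1, e2]
    ring
  rw [hsplit]
  have J1 := hJl (Complex.I * ω)
  have J2 := hJl (-(Complex.I * ω))
  have J3 := hJl (2 * Real.pi * Complex.I * v)
  change _ * J _ = _ at J1 J2 J3
  generalize J (Complex.I * ω) = X1 at *
  generalize J (-(Complex.I * ω)) = X2 at *
  generalize J (2 * Real.pi * Complex.I * v) = X3 at *
  simp only [kernelSymbolFun, ← hA, ← hB, ← hC, ← hω]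
  -- trigonometric form of the exponentials at the endpoints
  have t1 : Complex.exp (Complex.I * ω * ((Δ / 2 : ℝ) : ℂ)) =
      Complex.cos (theta Δ c₁ c₂) + Complex.sin (theta Δ c₁ c₂) * Complex.I := by
    rw [← Complex.exp_mul_I, hth]; push_cast; ring_nf
  have t2 : Complex.exp (-(Complex.I * ω * ((Δ / 2 : ℝ) : ℂ))) =
      Complex.cos (theta Δ c₁ c₂) - Complex.sin (theta Δ c₁ c₂) * Complex.I := by
    have := Complex.exp_mul_I (-(theta Δ c₁ c₂ : ℂ))
    rw [Complex.cos_neg, Complex.sin_neg, neg_mul, neg_mul, ← sub_eq_add_neg] at this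
    rw [← this, hth]; push_cast; ring_nf
  have t3 : Complex.exp (2 * Real.pi * Complex.I * v * ((Δ / 2 : ℝ) : ℂ)) =
      Complex.cos (Real.pi * Δ * v) + Complex.sin (Real.pi * Δ * v) * Complex.I := by
    rw [← Complex.exp_mul_I]; push_cast; ring_nf
  have t4 : Complex.exp (-(2 * Real.pi * Complex.I * v * ((Δ / 2 : ℝ) : ℂ))) =
      Complex.cos (Real.pi * Δ * v) - Complex.sin (Real.pi * Δ * v) * Complex.I := by
    have := Complex.exp_mul_I (-((Real.pi : ℂ) * Δ * v))
    rw [Complex.cos_neg, Complex.sin_neg, neg_mul, neg_mul, ← sub_eq_add_neg] at this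
    rw [← this]; push_cast; ring_nf
  have t5 : Complex.exp (Complex.I * ω * t) =
      Complex.cos (ω * t) + Complex.sin (ω * t) * Complex.I := by
    rw [← Complex.exp_mul_I]; ring_nf
  have t6 : Complex.exp (-(Complex.I * ω) * t) =
      Complex.cos (ω * t) - Complex.sin (ω * t) * Complex.I := by
    have := Complex.exp_mul_I (-((ω : ℂ) * t))
    rw [Complex.cos_neg, Complex.sin_neg, neg_mul, neg_mul, ← sub_eq_add_neg] at this
    rw [← this]; ring_nf
  have t7 : Complex.exp (-(-(Complex.I * ω) * ((Δ / 2 : ℝ) : ℂ))) =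
      Complex.exp (Complex.I * ω * ((Δ / 2 : ℝ) : ℂ)) := by ring_nf
  have t8 : Complex.exp (-(Complex.I * ω) * ((Δ / 2 : ℝ) : ℂ)) =
      Complex.exp (-(Complex.I * ω * ((Δ / 2 : ℝ) : ℂ))) := by ring_nf
  rw [t1, t2, t5] at J1
  rw [t7, t8, t1, t2, t6] at J2
  rw [t3, t4] at J3
  have hA' : A * (c₁ * (2 * c₁ * Real.pi ^ 2 * v ^ 2 - c₂) *
      (2 * Complex.cos (theta Δ c₁ c₂) + ω * Δ * Complex.sin (theta Δ c₁ c₂))) =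
      -2 * c₂ * (Complex.cos (Real.pi * Δ * v) + Real.pi * Δ * v * Complex.sin (Real.pi * Δ * v)) := by
    have : (2 * Complex.cos (theta Δ c₁ c₂) + ω * Δ * Complex.sin (theta Δ c₁ c₂)) =
      ((2 * Real.cos (theta Δ c₁ c₂) +
        √(2 * c₂ / c₁) * Δ * Real.sin (theta Δ c₁ c₂) : ℝ) : ℂ) := by
      rw [hω, freq]; push_cast; rfl
    rw [this, hA, coefA, div_mul_cancel₀]
    exact mul_ne_zero (mul_ne_zero hc₁' hD) hden
  have hB' : B * ((2 * c₁ * Real.pi ^ 2 * v ^ 2 - c₂) * Complex.cos (theta Δ c₁ c₂)) =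
      ω * (Complex.I * Real.pi * v * Complex.cos (Real.pi * Δ * v)) := by
    rw [hB, coefB, Complex.ofReal_cos] at *
    rw [mul_assoc, div_mul_cancel₀ _ (mul_ne_zero hD hcos), hω, freq]
  have hC' : C * (2 * c₁ * Real.pi ^ 2 * v ^ 2 - c₂) = 2 * Real.pi ^ 2 * v ^ 2 := by
    rw [hC, coefC, div_mul_cancel₀ _ hD]
  push_cast at J1 J2 J3
  -- `S`, `T` and `U` record the action on cosine, sine and exponential. Here `c₁ω² = 2c₂` cancels
  -- the cosine and leaves a constant.
  have S : (c₂ : ℂ) * (X1 + X2) = -c₁ * (2 * Complex.cos (ω * t) -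
      (2 * Complex.cos (theta Δ c₁ c₂) + ω * Δ * Complex.sin (theta Δ c₁ c₂))) := by
    linear_combination (-(c₁ : ℂ) / 2) * J1 + (-(c₁ : ℂ) / 2) * J2 - ((X1 + X2) / 2) * hωsq +
      ((c₁ : ℂ) / 2) * (ω ^ 2 * (X1 + X2) - 2 * ω * Δ * Complex.sin (theta Δ c₁ c₂)) * Complex.I_sq
  have T : Complex.I * (c₂ * (X1 - X2)) = c₁ * (2 * Complex.sin (ω * t) -
      2 * ω * t * Complex.cos (theta Δ c₁ c₂)) := by
    have T' : (c₂ : ℂ) * (X1 - X2) = -c₁ * Complex.I * (2 * Complex.sin (ω * t) -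
      2 * ω * t * Complex.cos (theta Δ c₁ c₂)) := by
      linear_combination (-(c₁ : ℂ) / 2) * J1 - (-(c₁ : ℂ) / 2) * J2 - ((X1 - X2) / 2) * hωsq +
        ((c₁ : ℂ) / 2) * (ω ^ 2 * (X1 - X2)) * Complex.I_sq
    rw [T']
    linear_combination (-c₁ * (2 * Complex.sin (ω * t) -
      2 * ω * t * Complex.cos (theta Δ c₁ c₂))) * Complex.I_sq
  have U : -4 * Real.pi ^ 2 * v ^ 2 * X3 = 2 * Complex.exp (2 * Real.pi * Complex.I * v * t) -
      2 * Complex.cos (Real.pi * Δ * v) - 4 * Real.pi * Complex.I * v * t *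
        Complex.cos (Real.pi * Δ * v) - 2 * Real.pi * Δ * v * Complex.sin (Real.pi * Δ * v) := by
    linear_combination J3 + (2 * Real.pi * Δ * v * Complex.sin (Real.pi * Δ * v) -
      4 * Real.pi ^ 2 * v ^ 2 * X3) * Complex.I_sq
  -- After clearing the denominator, `hC'` matches the exponential, `hA'` cancels the constant terms
  -- and `hB'` the terms linear in `t`.
  refine mul_left_cancel₀ hD ?_
  linear_combination (2 * c₁ * Real.pi ^ 2 * v ^ 2 - c₂) * A / 2 * S +
    (2 * c₁ * Real.pi ^ 2 * v ^ 2 - c₂) * B / 2 * T +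
    (c₁ * Complex.exp (2 * Real.pi * Complex.I * v * t) + c₂ * X3) * hC' - (c₂ / 2) * U +
    hA' / 2 - c₁ * ω * t * hB' - t * Complex.I * Real.pi * v * Complex.cos (Real.pi * Δ * v) * hωsq

/-! ### The reproducing property -/

/-- The restriction of the solution of the integral equation to `[-Δ/2, Δ/2]`. -/
def kernelSymbol (Δ c₁ c₂ : ℝ) (v : ℂ) : ℝ → ℂ :=
  (Set.Icc (-(Δ / 2)) (Δ / 2)).indicator (kernelSymbolFun Δ c₁ c₂ v)

theorem pwSymbol_indicator {b : ℝ} {g : ℝ → ℂ} (hg : Continuous g) :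
    PWSymbol b ((Set.Icc (-b) b).indicator g) := by
  obtain ⟨C, hC⟩ := (isCompact_Icc (a := -b) (b := b)).exists_bound_of_continuousOn hg.continuousOn
  refine PWSymbol.of_bounded (C := max C 0) (hg.aestronglyMeasurable.indicator measurableSet_Icc)
    (fun t => ?_) fun t ht => ?_
  · by_cases ht : t ∈ Set.Icc (-b) b
    · rw [Set.indicator_of_mem ht]
      exact (hC t ht).trans (le_max_left _ _)
    · rw [Set.indicator_of_notMem ht, norm_zero]
      exact le_max_right _ _
  · refine Set.indicator_of_notMem (fun hc => ?_) _
    exact absurd (abs_le.2 hc) (not_le.2 ht)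

theorem pwTransform_indicator {b : ℝ} (hb : 0 ≤ b) (g : ℝ → ℂ) (z : ℂ) :
    pwTransform ((Set.Icc (-b) b).indicator g) z =
      ∫ t in (-b)..b, g t * Complex.exp (-2 * Real.pi * Complex.I * t * z) := by
  rw [pwTransform, intervalIntegral.integral_of_le (by linarith), ← integral_Icc_eq_integral_Ioc,
    ← integral_indicator measurableSet_Icc]
  refine integral_congr_ae (ae_of_all _ fun t => ?_)
  simp only [Set.indicator_apply]
  split_ifs <;> simp

section kernel

variable {Δ c₁ c₂ : ℝ}

theorem pwSymbol_kernelSymbol (v : ℂ) : PWSymbol (Δ / 2) (kernelSymbol Δ c₁ c₂ v) :=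
  pwSymbol_indicator (continuous_kernelSymbolFun Δ c₁ c₂ v)

/-- For `s` and `t` in `[-Δ/2, Δ/2]` the difference lies in `[-Δ, Δ]`, so the cut-off of the density
is invisible. -/
theorem convolution_kernelSymbol (hΔ : 0 < Δ) (v : ℂ) {t : ℝ} (h1 : -(Δ / 2) ≤ t)
    (h2 : t ≤ Δ / 2) :
    convolution (kernelSymbol Δ c₁ c₂ v) (absDensity Δ c₂) (ContinuousLinearMap.mul ℂ ℂ) volume t =
      c₂ * ∫ s in (-(Δ / 2))..(Δ / 2), ((|t - s| : ℝ) : ℂ) * kernelSymbolFun Δ c₁ c₂ v s := by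
  rw [convolution, ← intervalIntegral.integral_const_mul,
    intervalIntegral.integral_of_le (by linarith), ← integral_Icc_eq_integral_Ioc,
    ← integral_indicator measurableSet_Icc]
  refine integral_congr_ae (ae_of_all _ fun s => ?_)
  simp only [ContinuousLinearMap.mul_apply', kernelSymbol]
  by_cases hs : s ∈ Set.Icc (-(Δ / 2)) (Δ / 2)
  · have hts : t - s ∈ Set.Icc (-Δ) Δ := ⟨by linarith [hs.2], by linarith [hs.1]⟩
    rw [Set.indicator_of_mem hs, Set.indicator_of_mem hs, absDensity, Set.indicator_of_mem hts]
    push_cast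
    ring
  · rw [Set.indicator_of_notMem hs, Set.indicator_of_notMem hs, zero_mul]

/-- The kernel function multiplied with `ν̂` is the Fourier transform of a function which
extends `t ↦ e^{2πivt}` from `[-Δ/2, Δ/2]`. -/
theorem exists_fourier_eq_weight_mul (hΔ : 0 < Δ) (hc₁ : 0 < c₁) (hc₂ : 0 ≤ c₂)
    (h : c₂ / c₁ * Δ ^ 2 ≤ 5 / 3) {v : ℂ} (hv : v ∉ exceptionalPoints c₁ c₂) :
    ∃ Ψ : ℝ → ℂ, Integrable Ψ ∧ MemLp Ψ 2 ∧
      (∀ x : ℝ, 𝓕 Ψ x = weight Δ c₁ c₂ x * pwTransform (kernelSymbol Δ c₁ c₂ v) x) ∧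
      ∀ t ∈ Set.Icc (-(Δ / 2)) (Δ / 2), Ψ t = Complex.exp (2 * Real.pi * Complex.I * v * t) := by
  have hφ : PWSymbol (Δ / 2) (kernelSymbol Δ c₁ c₂ v) := pwSymbol_kernelSymbol v
  have hg := pwSymbol_absDensity Δ c₂
  set φ := kernelSymbol Δ c₁ c₂ v with hφdef
  set κ : ℝ → ℂ := convolution φ (absDensity Δ c₂) (ContinuousLinearMap.mul ℂ ℂ) volume with hκ
  have hκi : Integrable κ := hφ.integrable.integrable_convolution _ hg.integrable
  obtain ⟨C, hC⟩ : ∃ C, ∀ t, ‖absDensity Δ c₂ t‖ ≤ C := by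
    refine ⟨|c₂| * Δ, fun t => ?_⟩
    by_cases ht : t ∈ Set.Icc (-Δ) Δ
    · rw [absDensity, Set.indicator_of_mem ht, Complex.norm_real, norm_mul, Real.norm_eq_abs,
        Real.norm_eq_abs, abs_abs]
      exact mul_le_mul_of_nonneg_left (abs_le.2 ht) (abs_nonneg _)
    · rw [absDensity, Set.indicator_of_notMem ht, norm_zero]
      positivity
  have hκ2 : MemLp κ 2 := by
    refine memLp_two_of_integrable_of_norm_le (C := (∫ s, ‖φ s‖) * C) hκi fun t => ?_
    rw [hκ, convolution, ← integral_mul_const]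
    refine norm_integral_le_of_norm_le (hφ.integrable.norm.mul_const _) (ae_of_all _ fun s => ?_)
    rw [ContinuousLinearMap.mul_apply', norm_mul]
    exact mul_le_mul_of_nonneg_left (hC _) (norm_nonneg _)
  refine ⟨fun t => c₁ * φ t + κ t, (hφ.integrable.const_mul _).add hκi,
    (hφ.memLp.const_mul _).add hκ2, fun x => ?_, fun t ht => ?_⟩
  · have h1 : 𝓕 (fun t => c₁ * φ t + κ t) x = c₁ * 𝓕 φ x + 𝓕 κ x := by
      have e1 := VectorFourier.fourierIntegral_add (L := innerₗ ℝ) Real.continuous_fourierChar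
        (by fun_prop) (hφ.integrable.const_mul (c₁ : ℂ)) hκi
      have e2 := congrFun e1 x
      have e3 : VectorFourier.fourierIntegral Real.fourierChar volume (innerₗ ℝ)
          (fun t => (c₁ : ℂ) * φ t) x = c₁ * 𝓕 φ x := by
        have := VectorFourier.fourierIntegral_const_smul Real.fourierChar volume (innerₗ ℝ) φ (c₁ : ℂ)
        exact congrFun this x
      rw [Pi.add_apply, e3] at e2
      exact e2
    rw [h1, hκ, Real.fourier_mul_convolution_eq hφ.integrable hg.integrable, ofReal_weight hΔ.le,
      pwTransform_ofReal]
    ring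
  · simp only
    rw [hκ, convolution_kernelSymbol hΔ v ht.1 ht.2, hφdef, kernelSymbol, Set.indicator_of_mem ht]
    exact kernelSymbolFun_integral_equation hΔ hc₁ hc₂ h hv ht.1 ht.2

/-- By Plancherel the integral is that of `conj Ψ · χ`. Since `χ` lives on `[-Δ/2, Δ/2]`, only the
values of `Ψ` there matter, and there it is the exponential representing evaluation at `w`. -/
theorem integral_conj_kernel_mul (hΔ : 0 < Δ) (hc₁ : 0 < c₁) (hc₂ : 0 ≤ c₂)
    (h : c₂ / c₁ * Δ ^ 2 ≤ 5 / 3) {w : ℂ} (hw : w ∉ exceptionalPoints c₁ c₂) {χ : ℝ → ℂ}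
    (hχ : PWSymbol (Δ / 2) χ) :
    ∫ x : ℝ, conj (pwTransform (kernelSymbol Δ c₁ c₂ (conj w)) x) * pwTransform χ x *
      nuHat (nuMeasure Δ c₁ c₂) x = pwTransform χ w := by
  obtain ⟨Ψ, hΨ1, hΨ2, hΨF, hΨe⟩ := exists_fourier_eq_weight_mul hΔ hc₁ hc₂ h
    (fun hc => hw (conj_mem_exceptionalPoints.1 hc))
  have e1 : ∀ x : ℝ, conj (pwTransform (kernelSymbol Δ c₁ c₂ (conj w)) x) * pwTransform χ x *
      nuHat (nuMeasure Δ c₁ c₂) x = conj (𝓕 Ψ x) * 𝓕 χ x := fun x => by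
    rw [hΨF, nuHat_eq_weight hΔ.le hc₁.le hc₂, map_mul, Complex.conj_ofReal, pwTransform_ofReal χ]
    ring
  simp only [e1]
  rw [integral_conj_fourier_mul_fourier hΨ1 hΨ2 hχ.integrable hχ.memLp,
    ← hχ.integral_conj_cutExp_mul w]
  refine integral_congr_ae (ae_of_all _ fun t => ?_)
  simp only
  by_cases ht : t ∈ Set.Icc (-(Δ / 2)) (Δ / 2)
  · rw [hΨe t ht, cutExp, Set.indicator_of_mem ht]
    congr 3
    ring
  · have : χ t = 0 := hχ.eq_zero t (by
      by_contra hc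
      exact ht (abs_le.1 (not_lt.1 hc)))
    rw [this, mul_zero, mul_zero]

theorem repKernel_eq_pwTransform (hΔ : 0 < Δ) (hc₁ : 0 < c₁) (hc₂ : 0 ≤ c₂)
    (h : c₂ / c₁ * Δ ^ 2 ≤ 5 / 3) (H : Type*) [NormedAddCommGroup H] [InnerProductSpace ℂ H]
    [CompleteSpace H] [RKHS ℂ H ℂ ℂ] (hH : IsWeightedPW Δ (nuMeasure Δ c₁ c₂) H) {w : ℂ}
    (hw : w ∉ exceptionalPoints c₁ c₂) (z : ℂ) :
    repKernel H w z = pwTransform (kernelSymbol Δ c₁ c₂ (conj w)) z := by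
  have hmem : pwTransform (kernelSymbol Δ c₁ c₂ (conj w)) ∈ weightedPW Δ (nuMeasure Δ c₁ c₂) :=
    (mem_weightedPW_iff hΔ hc₁ hc₂ h _).2 ⟨_, pwSymbol_kernelSymbol _, rfl⟩
  rw [← hH.1] at hmem
  obtain ⟨k, hk⟩ := hmem
  have hkz : ∀ z, k z = pwTransform (kernelSymbol Δ c₁ c₂ (conj w)) z := fun z => congrFun hk z
  have : RKHS.kerFun H w (1 : ℂ) = k := by
    refine ext_inner_right ℂ fun f => ?_
    obtain ⟨χ, hχ, hf⟩ := (mem_weightedPW_iff hΔ hc₁ hc₂ h _).1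
      (hH.1 ▸ Set.mem_range_self f : (fun z => f z) ∈ weightedPW Δ (nuMeasure Δ c₁ c₂))
    have hfz : ∀ z, f z = pwTransform χ z := fun z => congrFun hf z
    rw [hH.2 k f]
    simp only [hkz, hfz]
    rw [integral_conj_kernel_mul hΔ hc₁ hc₂ h hw hχ]
    simp [hfz]
  rw [repKernel, this, hkz]

/-! ### The explicit formula -/

theorem integral_exp_eq_sincKernel (Δ : ℝ) (u : ℂ) :
    ∫ t in (-(Δ / 2))..(Δ / 2), Complex.exp (2 * Real.pi * Complex.I * u * t) = sincKernel Δ u := by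
  have hm := mul_integral_exp (2 * Real.pi * Complex.I * u) (Δ / 2)
  rw [sincKernel]
  split_ifs with hu
  · subst hu
    simp
  · have hpi : (Real.pi : ℂ) ≠ 0 := by exact_mod_cast Real.pi_ne_zero
    have hn : 2 * (Real.pi : ℂ) * Complex.I * u ≠ 0 := by
      simp [hu, hpi]
    refine mul_left_cancel₀ hn ?_
    rw [hm]
    have t3 : Complex.exp (2 * Real.pi * Complex.I * u * ((Δ / 2 : ℝ) : ℂ)) =
        Complex.cos (Real.pi * Δ * u) + Complex.sin (Real.pi * Δ * u) * Complex.I := by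
      rw [← Complex.exp_mul_I]; push_cast; ring_nf
    have t4 : Complex.exp (-(2 * Real.pi * Complex.I * u * ((Δ / 2 : ℝ) : ℂ))) =
        Complex.cos (Real.pi * Δ * u) - Complex.sin (Real.pi * Δ * u) * Complex.I := by
      have := Complex.exp_mul_I (-((Real.pi : ℂ) * Δ * u))
      rw [Complex.cos_neg, Complex.sin_neg, neg_mul, neg_mul, ← sub_eq_add_neg] at this
      rw [← this]; push_cast; ring_nf
    rw [t3, t4]
    field_simp
    ring

/-- On the interval, `cos ωt` has transform `q` and `sin ωt` has transform `-r`; the exponential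
gives the sinc term. Only `z` must be non-exceptional, because the coefficients in `w` enter
linearly and unevaluated. -/
theorem pwTransform_kernelSymbol (hΔ : 0 < Δ) (hc₁ : 0 < c₁) (hc₂ : 0 ≤ c₂) {w z : ℂ}
    (hz : z ∉ exceptionalPoints c₁ c₂) :
    pwTransform (kernelSymbol Δ c₁ c₂ (conj w)) z = kernelFormula Δ c₁ c₂ w z := by
  have hD := denominator_ne_zero hc₁ hc₂ hz
  set ω : ℝ := freq c₁ c₂ with hω
  have hωsq : (c₁ : ℂ) * (ω : ℂ) ^ 2 = 2 * c₂ := by exact_mod_cast freq_sq hc₁ hc₂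
  have hth : theta Δ c₁ c₂ = ω * (Δ / 2) := freq_mul_half.symm
  set E : ℂ → ℂ := fun l => ∫ t in (-(Δ / 2))..(Δ / 2), Complex.exp (l * t) with hE
  have hEl : ∀ l, l * E l = Complex.exp (l * ((Δ / 2 : ℝ) : ℂ)) -
      Complex.exp (-(l * ((Δ / 2 : ℝ) : ℂ))) := fun l => mul_integral_exp l (Δ / 2)
  have hint : ∀ l : ℂ, IntervalIntegrable (fun t : ℝ => Complex.exp (l * t)) volume
    (-(Δ / 2)) (Δ / 2) := fun l => Continuous.intervalIntegrable (by fun_prop) _ _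
  rw [kernelSymbol, pwTransform_indicator (by linarith), kernelFormula,
    ← integral_exp_eq_sincKernel]
  set A := coefA Δ c₁ c₂ (conj w) with hA
  set B := coefB Δ c₁ c₂ (conj w) with hB
  set C := coefC c₁ c₂ (conj w) with hC
  have hsplit : ∫ t in (-(Δ / 2))..(Δ / 2), kernelSymbolFun Δ c₁ c₂ (conj w) t *
      Complex.exp (-2 * Real.pi * Complex.I * t * z) =
      (A / 2 + B * Complex.I / 2) * E (Complex.I * (ω - 2 * Real.pi * z)) +
        (A / 2 - B * Complex.I / 2) * E (-(Complex.I * (ω + 2 * Real.pi * z))) +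
        C * E (-(2 * Real.pi * Complex.I * (z - conj w))) := by
    simp only [hE]
    rw [← intervalIntegral.integral_const_mul, ← intervalIntegral.integral_const_mul,
      ← intervalIntegral.integral_const_mul, ← intervalIntegral.integral_add
        ((hint _).const_mul _) ((hint _).const_mul _), ← intervalIntegral.integral_add
        (((hint _).const_mul _).add ((hint _).const_mul _)) ((hint _).const_mul _)]
    refine intervalIntegral.integral_congr fun t _ => ?_
    simp only [kernelSymbolFun, Complex.cos, Complex.sin, ← hA, ← hB, ← hC, ← hω]
    have e1 : Complex.exp (Complex.I * (ω - 2 * Real.pi * z) * t) =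
        Complex.exp (ω * t * Complex.I) * Complex.exp (-2 * Real.pi * Complex.I * t * z) := by
      rw [← Complex.exp_add]; ring_nf
    have e2 : Complex.exp (-(Complex.I * (ω + 2 * Real.pi * z)) * t) =
        Complex.exp (-(ω * t) * Complex.I) * Complex.exp (-2 * Real.pi * Complex.I * t * z) := by
      rw [← Complex.exp_add]; ring_nf
    have e3 : Complex.exp (-(2 * Real.pi * Complex.I * (z - conj w)) * t) =
        Complex.exp (2 * Real.pi * Complex.I * conj w * t) *
          Complex.exp (-2 * Real.pi * Complex.I * t * z) := by
      rw [← Complex.exp_add]; ring_nf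
    rw [e1, e2, e3]
    ring
  have hsinc : E (-(2 * Real.pi * Complex.I * (z - conj w))) =
      ∫ t in (-(Δ / 2))..(Δ / 2), Complex.exp (2 * Real.pi * Complex.I * (z - conj w) * t) := by
    have := intervalIntegral.integral_comp_neg (a := -(Δ / 2)) (b := Δ / 2)
      (fun t : ℝ => Complex.exp (2 * Real.pi * Complex.I * (z - conj w) * t))
    rw [neg_neg] at this
    rw [← this]
    refine intervalIntegral.integral_congr fun t _ => ?_
    simp only [Complex.ofReal_neg]
    ring_nf
  rw [hsplit, hsinc]
  congr 1
  have X1 := hEl (Complex.I * (ω - 2 * Real.pi * z))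
  have X2 := hEl (-(Complex.I * (ω + 2 * Real.pi * z)))
  generalize E (Complex.I * (ω - 2 * Real.pi * z)) = Y1 at *
  generalize E (-(Complex.I * (ω + 2 * Real.pi * z))) = Y2 at *
  have trig : ∀ x y : ℂ, Complex.exp (Complex.I * (x + y)) =
      (Complex.cos x * Complex.cos y - Complex.sin x * Complex.sin y) +
        (Complex.sin x * Complex.cos y + Complex.cos x * Complex.sin y) * Complex.I := fun x y => by
    rw [mul_comm, Complex.exp_mul_I, Complex.cos_add, Complex.sin_add]
  have t1 : Complex.exp (Complex.I * (ω - 2 * Real.pi * z) * ((Δ / 2 : ℝ) : ℂ)) =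
      Complex.exp (Complex.I * (theta Δ c₁ c₂ + -(Real.pi * Δ * z))) := by
    rw [hth]; push_cast; ring_nf
  have t2 : Complex.exp (-(Complex.I * (ω - 2 * Real.pi * z) * ((Δ / 2 : ℝ) : ℂ))) =
      Complex.exp (Complex.I * (-(theta Δ c₁ c₂) + Real.pi * Δ * z)) := by
    rw [hth]; push_cast; ring_nf
  have t3 : Complex.exp (-(Complex.I * (ω + 2 * Real.pi * z)) * ((Δ / 2 : ℝ) : ℂ)) =
      Complex.exp (Complex.I * (-(theta Δ c₁ c₂) + -(Real.pi * Δ * z))) := by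
    rw [hth]; push_cast; ring_nf
  have t4 : Complex.exp (-(-(Complex.I * (ω + 2 * Real.pi * z)) * ((Δ / 2 : ℝ) : ℂ))) =
      Complex.exp (Complex.I * (theta Δ c₁ c₂ + Real.pi * Δ * z)) := by
    rw [hth]; push_cast; ring_nf
  rw [t1, t2, trig, trig] at X1
  rw [t3, t4, trig, trig] at X2
  simp only [Complex.cos_neg, Complex.sin_neg] at X1 X2
  have hD' : (c₂ : ℂ) - 2 * c₁ * Real.pi ^ 2 * z ^ 2 ≠ 0 := by
    intro h0
    exact hD (by linear_combination -h0)
  rw [funQ, funR, sqrt_two_mul_mul hc₁, ← hω]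
  have hI := Complex.I_ne_zero
  have Y1' : (ω - 2 * Real.pi * z) * Y1 = 2 * (Complex.sin (theta Δ c₁ c₂) *
      Complex.cos (Real.pi * Δ * z) - Complex.cos (theta Δ c₁ c₂) * Complex.sin (Real.pi * Δ * z)) := by
    refine mul_left_cancel₀ hI ?_
    linear_combination X1
  have Y2' : (ω + 2 * Real.pi * z) * Y2 = 2 * (Complex.sin (theta Δ c₁ c₂) *
      Complex.cos (Real.pi * Δ * z) + Complex.cos (theta Δ c₁ c₂) * Complex.sin (Real.pi * Δ * z)) := by
    refine mul_left_cancel₀ hI ?_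
    linear_combination -X2
  -- Uses the factorisation `c₂ - 2c₁π²z² = (c₁/2)(ω - 2πz)(ω + 2πz)`.
  have Z1 : (c₂ - 2 * c₁ * Real.pi ^ 2 * z ^ 2) * Y1 = c₁ * (ω + 2 * Real.pi * z) *
      (Complex.sin (theta Δ c₁ c₂) * Complex.cos (Real.pi * Δ * z) -
        Complex.cos (theta Δ c₁ c₂) * Complex.sin (Real.pi * Δ * z)) := by
    linear_combination (c₁ / 2 * (ω + 2 * Real.pi * z)) * Y1' - Y1 / 2 * hωsq
  have Z2 : (c₂ - 2 * c₁ * Real.pi ^ 2 * z ^ 2) * Y2 = c₁ * (ω - 2 * Real.pi * z) *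
      (Complex.sin (theta Δ c₁ c₂) * Complex.cos (Real.pi * Δ * z) +
        Complex.cos (theta Δ c₁ c₂) * Complex.sin (Real.pi * Δ * z)) := by
    linear_combination (c₁ / 2 * (ω - 2 * Real.pi * z)) * Y2' - Y2 / 2 * hωsq
  refine mul_left_cancel₀ hD' ?_
  have hdiv : ∀ x : ℂ, (c₂ - 2 * c₁ * Real.pi ^ 2 * z ^ 2) * (x / (c₂ - 2 * c₁ * Real.pi ^ 2 * z ^ 2))
      = x := fun x => mul_div_cancel₀ _ hD'
  have d1 := hdiv ((c₁ * ω : ℝ) : ℂ)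
  have d2 := hdiv (2 * Real.pi * c₁ * z)
  push_cast at d1 d2 ⊢
  generalize (c₁ : ℂ) * ω / (c₂ - 2 * c₁ * Real.pi ^ 2 * z ^ 2) = g1 at *
  generalize 2 * (Real.pi : ℂ) * c₁ * z / (c₂ - 2 * c₁ * Real.pi ^ 2 * z ^ 2) = g2 at *
  linear_combination (A / 2 + B * Complex.I / 2) * Z1 + (A / 2 - B * Complex.I / 2) * Z2 -
    (A * Complex.sin (theta Δ c₁ c₂) * Complex.cos (Real.pi * Δ * z) -
      B * Complex.I * Complex.cos (theta Δ c₁ c₂) * Complex.sin (Real.pi * Δ * z)) * d1 -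
    (-A * Complex.cos (theta Δ c₁ c₂) * Complex.sin (Real.pi * Δ * z) +
      B * Complex.I * Complex.sin (theta Δ c₁ c₂) * Complex.cos (Real.pi * Δ * z)) * d2

end kernel

/-! ### Continuity of the reproducing kernel -/

/-- The Gram matrix of the evaluation vectors is one entire function of `w - conj w'`, so their norm
continuity reduces to continuity of that function. -/
theorem inner_cutExpLp_cutExpLp (b : ℝ) (w w' : ℂ) :
    inner ℂ (cutExpLp b w) (cutExpLp b w') = pwTransform (cutExp b 0) (w - conj w') := by
  rw [cutExpLp, cutExpLp, ← cutExpLp, (pwSymbol_cutExp b w').inner_cutExpLp, pwTransform, pwTransform]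
  refine integral_congr_ae (ae_of_all _ fun t => ?_)
  simp only [cutExp, Set.indicator_apply]
  split_ifs
  · rw [← Complex.exp_add, ← Complex.exp_add, map_zero]
    ring_nf
  · simp

theorem continuous_cutExpLp (b : ℝ) : Continuous (cutExpLp b) := by
  have hG : Continuous (pwTransform (cutExp b 0)) := (pwSymbol_cutExp b 0).differentiable.continuous
  have key : ∀ w w', ‖cutExpLp b w' - cutExpLp b w‖ ^ 2 =
      (pwTransform (cutExp b 0) (w' - conj w')).re -
        2 * (pwTransform (cutExp b 0) (w' - conj w)).re +
        (pwTransform (cutExp b 0) (w - conj w)).re := by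
    intro w w'
    rw [norm_sub_sq (𝕜 := ℂ), ← inner_cutExpLp_cutExpLp, ← inner_cutExpLp_cutExpLp,
      ← inner_cutExpLp_cutExpLp, ← inner_self_eq_norm_sq (𝕜 := ℂ), ← inner_self_eq_norm_sq (𝕜 := ℂ)]
    rfl
  rw [continuous_iff_continuousAt]
  intro w
  rw [ContinuousAt, tendsto_iff_norm_sub_tendsto_zero]
  have h2 : Tendsto (fun w' => ‖cutExpLp b w' - cutExpLp b w‖ ^ 2) (𝓝 w) (𝓝 0) := by
    have hc : Continuous fun w' => ‖cutExpLp b w' - cutExpLp b w‖ ^ 2 := by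
      simp only [key]
      have c1 : Continuous fun w' : ℂ => pwTransform (cutExp b 0) (w' - conj w') :=
        hG.comp (continuous_id.sub Complex.continuous_conj)
      have c2 : Continuous fun w' : ℂ => pwTransform (cutExp b 0) (w' - conj w) :=
        hG.comp (continuous_id.sub continuous_const)
      exact ((Complex.continuous_re.comp c1).sub
        (continuous_const.mul (Complex.continuous_re.comp c2))).add continuous_const
    simpa using hc.tendsto w
  simpa using h2.sqrt

section continuity

variable {Δ c₁ c₂ : ℝ}

/-- Differences of values are controlled by the norm of `𝓗_ν`. -/
theorem exists_norm_sub_le (hΔ : 0 < Δ) (hc₁ : 0 < c₁) (hc₂ : 0 ≤ c₂)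
    (h : c₂ / c₁ * Δ ^ 2 ≤ 5 / 3) (H : Type*) [NormedAddCommGroup H] [InnerProductSpace ℂ H]
    [RKHS ℂ H ℂ ℂ] (hH : IsWeightedPW Δ (nuMeasure Δ c₁ c₂) H) :
    ∃ C, 0 ≤ C ∧ ∀ (f : H) (w w' : ℂ),
      ‖f w - f w'‖ ≤ C * ‖cutExpLp (Δ / 2) w - cutExpLp (Δ / 2) w'‖ * ‖f‖ := by
  obtain ⟨δ, hδ, hδw⟩ := exists_le_weight hc₁ hc₂ h
  refine ⟨(√δ)⁻¹, by positivity, fun f w w' => ?_⟩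
  obtain ⟨χ, hχ, hf⟩ := (mem_weightedPW_iff hΔ hc₁ hc₂ h _).1
    (hH.1 ▸ Set.mem_range_self f : (fun z => f z) ∈ weightedPW Δ (nuMeasure Δ c₁ c₂))
  have hfz : ∀ z, f z = pwTransform χ z := fun z => congrFun hf z
  have hmem : (fun z => f z) ∈ weightedPW Δ (nuMeasure Δ c₁ c₂) := hH.1 ▸ Set.mem_range_self f
  have hnorm : δ * ‖hχ.memLp.toLp χ‖ ^ 2 ≤ ‖f‖ ^ 2 := by
    have e1 : ‖hχ.memLp.toLp χ‖ ^ 2 = ∫ x : ℝ, ‖f x‖ ^ 2 := by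
      rw [← inner_self_eq_norm_sq (𝕜 := ℂ),
        inner_Lp_eq_integral hχ.memLp.coeFn_toLp hχ.memLp.coeFn_toLp]
      simp only [hfz, pwTransform_ofReal, integral_norm_sq_fourier hχ.integrable hχ.memLp,
        Complex.conj_mul', ← Complex.ofReal_pow, integral_complex_ofReal]
      rfl
    have hval : ∀ x : ℝ, conj (f x) * f x * nuHat (nuMeasure Δ c₁ c₂) x =
        ((‖f x‖ ^ 2 * weight Δ c₁ c₂ x : ℝ) : ℂ) := fun x => by
      rw [nuHat_eq_weight hΔ.le hc₁.le hc₂, Complex.conj_mul']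
      push_cast
      rfl
    have e2 : ‖f‖ ^ 2 = ∫ x : ℝ, ‖f x‖ ^ 2 * weight Δ c₁ c₂ x := by
      rw [← inner_self_eq_norm_sq (𝕜 := ℂ), hH.2 f f]
      simp only [hval, integral_complex_ofReal]
      rfl
    have hi : Integrable fun x : ℝ => ‖f x‖ ^ 2 * weight Δ c₁ c₂ x := by
      refine hmem.2.2.re.congr (ae_of_all _ fun x => ?_)
      simp only [nuHat_eq_weight hΔ.le hc₁.le hc₂, ← Complex.ofReal_mul]
      exact Complex.ofReal_re _
    have h2 : MemLp (fun x : ℝ => f x) 2 := by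
      simp only [hfz]
      exact hχ.memLp_pwTransform
    rw [e1, e2, ← integral_const_mul]
    refine integral_mono (((memLp_two_iff_integrable_sq_norm h2.aestronglyMeasurable).1 h2).const_mul _)
      hi fun x => ?_
    simp only
    rw [mul_comm]
    exact mul_le_mul_of_nonneg_left (hδw x) (by positivity)
  have hnorm' : ‖hχ.memLp.toLp χ‖ ≤ (√δ)⁻¹ * ‖f‖ := by
    rw [inv_mul_eq_div, le_div_iff₀ (Real.sqrt_pos.2 hδ)]
    refine abs_le_of_sq_le_sq' ?_ (norm_nonneg _) |>.2
    rw [mul_pow, Real.sq_sqrt hδ.le]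
    linarith
  have : f w - f w' = inner ℂ (cutExpLp (Δ / 2) w - cutExpLp (Δ / 2) w') (hχ.memLp.toLp χ) := by
    rw [inner_sub_left, hχ.inner_cutExpLp, hχ.inner_cutExpLp, hfz, hfz]
  rw [this]
  refine (norm_inner_le_norm _ _).trans ?_
  rw [mul_comm (√δ)⁻¹, mul_assoc]
  exact mul_le_mul_of_nonneg_left hnorm' (norm_nonneg _)

/-- Apply `exists_norm_sub_le` to the difference `f` of two kernel functions itself: `‖f‖² = f w - f
w'`, and one factor `‖f‖` cancels. -/
theorem continuous_kerFun_one (hΔ : 0 < Δ) (hc₁ : 0 < c₁) (hc₂ : 0 ≤ c₂)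
    (h : c₂ / c₁ * Δ ^ 2 ≤ 5 / 3) (H : Type*) [NormedAddCommGroup H] [InnerProductSpace ℂ H]
    [CompleteSpace H] [RKHS ℂ H ℂ ℂ] (hH : IsWeightedPW Δ (nuMeasure Δ c₁ c₂) H) :
    Continuous fun w : ℂ => RKHS.kerFun H w (1 : ℂ) := by
  obtain ⟨C, hC0, hC⟩ := exists_norm_sub_le hΔ hc₁ hc₂ h H hH
  have key : ∀ w w' : ℂ, ‖RKHS.kerFun H w (1 : ℂ) - RKHS.kerFun H w' (1 : ℂ)‖ ≤
      C * ‖cutExpLp (Δ / 2) w - cutExpLp (Δ / 2) w'‖ := by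
    intro w w'
    set f : H := RKHS.kerFun H w (1 : ℂ) - RKHS.kerFun H w' (1 : ℂ) with hf
    rcases eq_or_ne f 0 with h0 | h0
    · rw [h0, norm_zero]
      positivity
    · have h1 : ‖f‖ * ‖f‖ ≤ C * ‖cutExpLp (Δ / 2) w - cutExpLp (Δ / 2) w'‖ * ‖f‖ := by
        refine le_trans (le_of_eq ?_) (hC f w w')
        have h2 : inner ℂ f f = f w - f w' := by
          nth_rw 1 [hf]
          rw [inner_sub_left]
          simp
        rw [← h2, inner_self_eq_norm_sq_to_K, norm_pow]
        simp [sq]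
      exact le_of_mul_le_mul_right h1 (norm_pos_iff.2 h0)
  rw [continuous_iff_continuousAt]
  intro w
  rw [ContinuousAt, tendsto_iff_norm_sub_tendsto_zero]
  refine squeeze_zero (fun w' => norm_nonneg _) (fun w' => key w' w) ?_
  have := ((((continuous_cutExpLp (Δ / 2)).sub continuous_const).norm.const_mul C).tendsto w :
    Tendsto (fun w' => C * ‖cutExpLp (Δ / 2) w' - cutExpLp (Δ / 2) w‖) (𝓝 w) _)
  simpa using this

/-- The kernel is the inner product of the kernel functions at `z` and `w`, both norm-continuous in
their points. -/
theorem continuous_repKernel (hΔ : 0 < Δ) (hc₁ : 0 < c₁) (hc₂ : 0 ≤ c₂)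
    (h : c₂ / c₁ * Δ ^ 2 ≤ 5 / 3) (H : Type*) [NormedAddCommGroup H] [InnerProductSpace ℂ H]
    [CompleteSpace H] [RKHS ℂ H ℂ ℂ] (hH : IsWeightedPW Δ (nuMeasure Δ c₁ c₂) H) :
    Continuous fun p : ℂ × ℂ => repKernel H p.1 p.2 := by
  have hk := continuous_kerFun_one hΔ hc₁ hc₂ h H hH
  have e : (fun p : ℂ × ℂ => repKernel H p.1 p.2) =
      fun p : ℂ × ℂ => inner ℂ (RKHS.kerFun H p.2 (1 : ℂ)) (RKHS.kerFun H p.1 (1 : ℂ)) := by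
    funext p
    rw [RKHS.kerFun_inner]
    simp [repKernel]
  rw [e]
  exact (hk.comp continuous_snd).inner (hk.comp continuous_fst)

end continuity

end PairCorrelation

end

/-! ### The theorem. -/

theorem mainTheorem12 (Δ c₁ c₂ : ℝ) (hΔ : 0 < Δ) (hc₁ : 0 < c₁) (hc₂ : 0 ≤ c₂)
    (h : c₂ / c₁ * Δ ^ 2 ≤ 5 / 3) :
    -- `𝓗_ν` is a reproducing kernel Hilbert space
    (∃ (H : Type) (_ : NormedAddCommGroup H) (_ : InnerProductSpace ℂ H) (_ : CompleteSpace H)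
      (_ : RKHS ℂ H ℂ ℂ), PairCorrelation.IsWeightedPW Δ (PairCorrelation.nuMeasure Δ c₁ c₂) H) ∧
    -- and its reproducing kernel is given by the formula
    (∀ (H : Type*) [NormedAddCommGroup H] [InnerProductSpace ℂ H] [CompleteSpace H]
      [RKHS ℂ H ℂ ℂ], PairCorrelation.IsWeightedPW Δ (PairCorrelation.nuMeasure Δ c₁ c₂) H →
      ∀ w z : ℂ,
        (w ∉ PairCorrelation.exceptionalPoints c₁ c₂ →
          z ∉ PairCorrelation.exceptionalPoints c₁ c₂ →
          PairCorrelation.repKernel H w z = PairCorrelation.kernelFormula Δ c₁ c₂ w z) ∧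
        (w ∈ PairCorrelation.exceptionalPoints c₁ c₂ ∨
            z ∈ PairCorrelation.exceptionalPoints c₁ c₂ →
          Tendsto (fun p : ℂ × ℂ => PairCorrelation.kernelFormula Δ c₁ c₂ p.1 p.2)
            (𝓝[(PairCorrelation.exceptionalPoints c₁ c₂)ᶜ ×ˢ
              (PairCorrelation.exceptionalPoints c₁ c₂)ᶜ] (w, z))
            (𝓝 (PairCorrelation.repKernel H w z)))) := by
  refine ⟨PairCorrelation.exists_isWeightedPW hΔ hc₁ hc₂ h, fun H _ _ _ _ hH w z => ?_⟩
  have formula : ∀ w z : ℂ, w ∉ PairCorrelation.exceptionalPoints c₁ c₂ →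
      z ∉ PairCorrelation.exceptionalPoints c₁ c₂ →
      PairCorrelation.repKernel H w z = PairCorrelation.kernelFormula Δ c₁ c₂ w z := by
    intro w z hw hz
    rw [PairCorrelation.repKernel_eq_pwTransform hΔ hc₁ hc₂ h H hH hw z,
      PairCorrelation.pwTransform_kernelSymbol hΔ hc₁ hc₂ hz]
  refine ⟨formula w z, fun _ => ?_⟩
  -- The limit at exceptional points is that of the continuous kernel, which coincides with the
  -- formula on the set approached.
  have hlim : Tendsto (fun p : ℂ × ℂ => PairCorrelation.repKernel H p.1 p.2)
      (𝓝[(PairCorrelation.exceptionalPoints c₁ c₂)ᶜ ×ˢ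
        (PairCorrelation.exceptionalPoints c₁ c₂)ᶜ] (w, z))
      (𝓝 (PairCorrelation.repKernel H w z)) :=
    ((PairCorrelation.continuous_repKernel hΔ hc₁ hc₂ h H hH).tendsto (w, z)).mono_left
      nhdsWithin_le_nhds
  exact hlim.congr' (eventually_nhdsWithin_of_forall fun p hp => formula p.1 p.2 hp.1 hp.2)
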